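/- Let $q,b\in\mathbb C$ with $0<|q|<1$ and $|b|<1$, and let $\omega=e^{2\pi i/3}$. Write $(a;q)_n=\prod_{j=0}^{n-1}(1-aq^j)$, $(a;q)_\infty=\prod_{j\ge 0}(1-aq^j)$ and $(a_1,\dots,a_k;q)_n=(a_1;q)_n\cdots(a_k;q)_n$ (also for $n=\infty$). The Askey–Wilson polynomials are $$p_n(\cos\theta;a_1,a_2,a_3,a_4|q)=\frac{(a_1a_2,a_1a_3,a_1a_4;q)_n}{a_1^n}\sum_{k=0}^n\frac{(q^{-n},a_1a_2a_3a_4q^{n-1},a_1e^{i\theta},a_1e^{-i\theta};q)_k}{(q,a_1a_2,a_1a_3,a_1a_4;q)_k}\,q^k,$$ which is a polynomial in $\cos\theta$. For Laurent polynomials $f,g\in\mathbb C[z,z^{-1}]$ put $$\langle f,g\rangle_0=\frac{(q^3;q^3)_\infty(b,b^2q;q)_\infty}{(b^3q^3;q^3)_\infty}\oint f(z)g(z)\,\frac1{1+z}\,\frac{(z^2,z^{-2};q^3)_\infty}{(z,z^{-1};q^3)_\infty(bz,bz^{-1};q)_\infty}\,\frac{dz}{2\pi i z},$$ with integration over the positively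 oriented unit circle; the integrand is integrable for all $f,g$ (its singularities on the circle, at $z=\pm1$, are removable). Then the Laurent polynomials, defined for $n\ge0$ by $$p_{2n}^{(0)}(z)=\frac1{(b^3q^{3n};q^3)_n}\,p_n\Big(\frac{z+z^{-1}}2;1,b,bq,bq^2\Big|q^3\Big),\qquad p_{2n+1}^{(0)}(z)=\frac{z-1}{(b^3q^{3n+3};q^3)_n}\,p_n\Big(\frac{z+z^{-1}}2;q^3,b,bq,bq^2\Big|q^3\Big),$$ satisfy $\langle p_m^{(0)},p_n^{(0)}\rangle_0=h_n^{(0)}\delta_{mn}$ for all $m,n\ge0$, where $$h_{2n}^{(0)}=\frac{(q^3,b^3;q^3)_n(b,b^2q;q)_{3n}}{(b^3,b^3q^3;q^3)_{2n}},\qquad h_{2n+1}^{(0)}=-\frac{(1-b)(1-bq^2)}{(1-\omega bq)(1-\omega^2bq)}\,\frac{(q^3,b^3q^3;q^3)_n(bq^3,b^2q;q)_{3n}}{(b^3q^3,b^3q^6;q^3)_{2n}}.$$ -/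

import Mathlib

noncomputable section

namespace AskeyWilsonLaurent

open Polynomial LaurentPolynomial

/-- The finite `q`-shifted factorial `(a;q)_n = (1-a)(1-aq)⋯(1-aq^{n-1})`. -/
def qPoch (a q : ℂ) (n : ℕ) : ℂ := ∏ j ∈ Finset.range n, (1 - a * q ^ j)

/-- The infinite `q`-shifted factorial `(a;q)_∞ = ∏_{j ≥ 0} (1-aq^j)`, used for `|q| < 1`. -/
def qPochInf (a q : ℂ) : ℂ := ∏' j : ℕ, (1 - a * q ^ j)

/-- For `|q| < 1` the infinite product converges. -/
theorem multipliable_qPochInf (a q : ℂ) (hq : ‖q‖ < 1) :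
    Multipliable fun j : ℕ => 1 - a * q ^ j := by
  have h : Summable fun j : ℕ => ‖-(a * q ^ j)‖ := by
    simpa [norm_mul, norm_pow] using (summable_geometric_of_lt_one (norm_nonneg q) hq).mul_left ‖a‖
  simpa [sub_eq_add_neg] using multipliable_one_add_of_summable h

/-- For `|q| < 1`, `(a;q)_∞` is the limit of `(a;q)_n`. -/
theorem tendsto_qPoch (a q : ℂ) (hq : ‖q‖ < 1) :
    Filter.Tendsto (qPoch a q) Filter.atTop (nhds (qPochInf a q)) :=
  (multipliable_qPochInf a q hq).hasProd.tendsto_prod_nat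

/-- The basic hypergeometric series `₄φ₃(a₁,a₂,a₃,a₄; b₁,b₂,b₃; q, x)`. -/
def phi43 (a₁ a₂ a₃ a₄ b₁ b₂ b₃ q x : ℂ) : ℂ :=
  ∑' k : ℕ, qPoch a₁ q k * qPoch a₂ q k * qPoch a₃ q k * qPoch a₄ q k /
    (qPoch q q k * qPoch b₁ q k * qPoch b₂ q k * qPoch b₃ q k) * x ^ k

/-- The Askey–Wilson polynomial `p_n(x; a₁,a₂,a₃,a₄ | q)` as a polynomial in `x`. The product
`(a₁ e^{iθ}, a₁ e^{-iθ}; q)_k` is written as `∏_{j<k} (1 - 2 a₁ q^j x + a₁² q^{2j})` with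
`x = cos θ`; see `askeyWilson_eval_cos` for the usual `₄φ₃` form. -/
def askeyWilson (n : ℕ) (a₁ a₂ a₃ a₄ q : ℂ) : ℂ[X] :=
  Polynomial.C (qPoch (a₁ * a₂) q n * qPoch (a₁ * a₃) q n * qPoch (a₁ * a₄) q n / a₁ ^ n) *
    ∑ k ∈ Finset.range (n + 1),
      Polynomial.C (qPoch (q ^ (-(n : ℤ))) q k *
          qPoch (a₁ * a₂ * a₃ * a₄ * q ^ ((n : ℤ) - 1)) q k /
          (qPoch q q k * qPoch (a₁ * a₂) q k * qPoch (a₁ * a₃) q k * qPoch (a₁ * a₄) q k) *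
          q ^ k) *
        ∏ j ∈ Finset.range k,
          (1 - Polynomial.C (2 * a₁ * q ^ j) * X + Polynomial.C (a₁ ^ 2 * q ^ (2 * j)))

theorem qPoch_neg_pow_eq_zero {q : ℂ} (hq : q ≠ 0) {n k : ℕ} (h : n < k) :
    qPoch (q ^ (-(n : ℤ))) q k = 0 := by
  refine Finset.prod_eq_zero (Finset.mem_range.2 h) ?_
  rw [zpow_neg, zpow_natCast, inv_mul_cancel₀ (pow_ne_zero n hq), sub_self]

/-- The Askey–Wilson polynomial at `cos θ` is the usual terminating `₄φ₃`. -/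
theorem askeyWilson_eval_cos (n : ℕ) (a₁ a₂ a₃ a₄ q θ : ℂ) (hq : q ≠ 0) :
    (askeyWilson n a₁ a₂ a₃ a₄ q).eval (Complex.cos θ) =
      qPoch (a₁ * a₂) q n * qPoch (a₁ * a₃) q n * qPoch (a₁ * a₄) q n / a₁ ^ n *
        phi43 (q ^ (-(n : ℤ))) (a₁ * a₂ * a₃ * a₄ * q ^ ((n : ℤ) - 1))
          (a₁ * Complex.exp (Complex.I * θ)) (a₁ * Complex.exp (-(Complex.I * θ)))
          (a₁ * a₂) (a₁ * a₃) (a₁ * a₄) q q := by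
  unfold askeyWilson phi43
  rw [tsum_eq_sum (s := Finset.range (n + 1))]
  · simp only [eval_mul, eval_C, eval_finsetSum, eval_prod]
    congr 1
    refine Finset.sum_congr rfl fun k _ => ?_
    have hp : ∏ j ∈ Finset.range k, Polynomial.eval (Complex.cos θ)
          (1 - Polynomial.C (2 * a₁ * q ^ j) * X + Polynomial.C (a₁ ^ 2 * q ^ (2 * j))) =
        qPoch (a₁ * Complex.exp (Complex.I * θ)) q k *
          qPoch (a₁ * Complex.exp (-(Complex.I * θ))) q k := by
      unfold qPoch
      rw [← Finset.prod_mul_distrib]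
      refine Finset.prod_congr rfl fun j _ => ?_
      have he : Complex.exp (Complex.I * θ) * Complex.exp (-(Complex.I * θ)) = 1 := by
        rw [← Complex.exp_add, add_neg_cancel, Complex.exp_zero]
      have hc : 2 * Complex.cos θ =
          Complex.exp (Complex.I * θ) + Complex.exp (-(Complex.I * θ)) := by
        rw [Complex.two_cos]
        ring_nf
      simp only [eval_add, eval_sub, eval_one, eval_mul, eval_C, eval_X]
      linear_combination (-a₁ * q ^ j) * hc - a₁ ^ 2 * q ^ (2 * j) * he
    rw [hp]
    ring
  · intro k hk
    rw [qPoch_neg_pow_eq_zero hq (by simpa using hk)]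
    simp

/-- The value of the Laurent polynomial `f` at the point `z` (for `z ≠ 0`). -/
def laurentEval (z : ℂ) (f : ℂ[T;T⁻¹]) : ℂ := f.coeff.sum fun k c => c * z ^ k

/-- For `z ≠ 0`, `laurentEval z` is the evaluation ring homomorphism. -/
theorem laurentEval_eq_eval₂ {z : ℂ} (hz : z ≠ 0) (f : ℂ[T;T⁻¹]) :
    laurentEval z f = LaurentPolynomial.eval₂ (RingHom.id ℂ) (Units.mk0 z hz) f := by
  have h1 : laurentEval z f = f.smeval (Units.mk0 z hz) := by
    simp [laurentEval, LaurentPolynomial.smeval_eq_sum]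
  rw [h1]
  induction f using LaurentPolynomial.induction_on' with
  | add p r hp hr =>
    rw [LaurentPolynomial.smeval_add, map_add, hp, hr]
    · simp [laurentEval, LaurentPolynomial.smeval_eq_sum]
    · simp [laurentEval, LaurentPolynomial.smeval_eq_sum]
  | C_mul_T k a =>
    rw [LaurentPolynomial.smeval_C_mul_T_n, LaurentPolynomial.eval₂_C_mul_T]
    simp

/-- The Laurent polynomial `(z + z⁻¹)/2`. -/
def cosLaurent : ℂ[T;T⁻¹] := LaurentPolynomial.C (1 / 2) * (T 1 + T (-1))

theorem laurentEval_aeval_cosLaurent {z : ℂ} (hz : z ≠ 0) (p : ℂ[X]) :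
    laurentEval z (Polynomial.aeval cosLaurent p) = p.eval ((z + z⁻¹) / 2) := by
  rw [laurentEval_eq_eval₂ hz, Polynomial.aeval_def, Polynomial.hom_eval₂, Polynomial.eval]
  congr 1
  · ext c
    simp
  · have h1 := LaurentPolynomial.eval₂_T (RingHom.id ℂ) (Units.mk0 z hz) 1
    have h2 := LaurentPolynomial.eval₂_T (RingHom.id ℂ) (Units.mk0 z hz) (-1)
    rw [cosLaurent, map_mul, map_add, h1, h2, LaurentPolynomial.eval₂_C]
    simp
    ring

/-- The even-index Laurent polynomial
`p_{2n}(z) = p_n((z+z⁻¹)/2; 1,b,bq,bq² | q³) / (b³q^{3n};q³)_n`. -/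
def pEven (q b : ℂ) (n : ℕ) : ℂ[T;T⁻¹] :=
  LaurentPolynomial.C (1 / qPoch (b ^ 3 * q ^ (3 * n)) (q ^ 3) n) *
    Polynomial.aeval cosLaurent (askeyWilson n 1 b (b * q) (b * q ^ 2) (q ^ 3))

/-- The odd-index Laurent polynomial
`p_{2n+1}(z) = (z-1) p_n((z+z⁻¹)/2; q³,b,bq,bq² | q³) / (b³q^{3n+3};q³)_n`. -/
def pOdd (q b : ℂ) (n : ℕ) : ℂ[T;T⁻¹] :=
  LaurentPolynomial.C (1 / qPoch (b ^ 3 * q ^ (3 * n + 3)) (q ^ 3) n) * (T 1 - 1) *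
    Polynomial.aeval cosLaurent (askeyWilson n (q ^ 3) b (b * q) (b * q ^ 2) (q ^ 3))

theorem laurentEval_pEven (q b : ℂ) (n : ℕ) {z : ℂ} (hz : z ≠ 0) :
    laurentEval z (pEven q b n) = 1 / qPoch (b ^ 3 * q ^ (3 * n)) (q ^ 3) n *
      (askeyWilson n 1 b (b * q) (b * q ^ 2) (q ^ 3)).eval ((z + z⁻¹) / 2) := by
  rw [← laurentEval_aeval_cosLaurent hz, pEven]
  simp only [laurentEval_eq_eval₂ hz, map_mul, LaurentPolynomial.eval₂_C, RingHom.id_apply]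

theorem laurentEval_pOdd (q b : ℂ) (n : ℕ) {z : ℂ} (hz : z ≠ 0) :
    laurentEval z (pOdd q b n) = (z - 1) / qPoch (b ^ 3 * q ^ (3 * n + 3)) (q ^ 3) n *
      (askeyWilson n (q ^ 3) b (b * q) (b * q ^ 2) (q ^ 3)).eval ((z + z⁻¹) / 2) := by
  have h1 := LaurentPolynomial.eval₂_T (RingHom.id ℂ) (Units.mk0 z hz) 1
  rw [← laurentEval_aeval_cosLaurent hz, pOdd]
  simp only [laurentEval_eq_eval₂ hz, map_mul, map_sub, map_one, h1, LaurentPolynomial.eval₂_C,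
    RingHom.id_apply, zpow_one, Units.val_mk0]
  ring

/-- The sequence `p_m`, with `p_{2n} = pEven n` and `p_{2n+1} = pOdd n`. -/
def pLaurent (q b : ℂ) (m : ℕ) : ℂ[T;T⁻¹] :=
  if Even m then pEven q b (m / 2) else pOdd q b (m / 2)

/-- The cube root of unity `ω = e^{2πi/3}`. -/
def omega : ℂ := Complex.exp (2 * Real.pi * Complex.I / 3)

/-- `h_{2n} = (q³,b³;q³)_n (b,b²q;q)_{3n} / (b³,b³q³;q³)_{2n}`. -/
def hEven (q b : ℂ) (n : ℕ) : ℂ :=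
  qPoch (q ^ 3) (q ^ 3) n * qPoch (b ^ 3) (q ^ 3) n *
      (qPoch b q (3 * n) * qPoch (b ^ 2 * q) q (3 * n)) /
    (qPoch (b ^ 3) (q ^ 3) (2 * n) * qPoch (b ^ 3 * q ^ 3) (q ^ 3) (2 * n))

/-- `h_{2n+1} = -((1-b)(1-bq²)/((1-ωbq)(1-ω²bq)))
  (q³,b³q³;q³)_n (bq³,b²q;q)_{3n} / (b³q³,b³q⁶;q³)_{2n}`. -/
def hOdd (q b : ℂ) (n : ℕ) : ℂ :=
  -((1 - b) * (1 - b * q ^ 2) / ((1 - omega * b * q) * (1 - omega ^ 2 * b * q))) *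
    (qPoch (q ^ 3) (q ^ 3) n * qPoch (b ^ 3 * q ^ 3) (q ^ 3) n *
        (qPoch (b * q ^ 3) q (3 * n) * qPoch (b ^ 2 * q) q (3 * n)) /
      (qPoch (b ^ 3 * q ^ 3) (q ^ 3) (2 * n) * qPoch (b ^ 3 * q ^ 6) (q ^ 3) (2 * n)))

/-- The sequence `h_m`, with `h_{2n} = hEven n` and `h_{2n+1} = hOdd n`. -/
def hNorm (q b : ℂ) (m : ℕ) : ℂ :=
  if Even m then hEven q b (m / 2) else hOdd q b (m / 2)

/-- The weight `(1/(1+z)) (z²,z⁻²;q³)_∞ / ((z,z⁻¹;q³)_∞ (bz,bz⁻¹;q)_∞)`. Its singularities at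
`z = ±1` are removable; the values at these two points do not affect the integral. -/
def weight (q b z : ℂ) : ℂ :=
  1 / (1 + z) *
    (qPochInf (z ^ 2) (q ^ 3) * qPochInf (z⁻¹ ^ 2) (q ^ 3) /
      (qPochInf z (q ^ 3) * qPochInf z⁻¹ (q ^ 3) * (qPochInf (b * z) q * qPochInf (b * z⁻¹) q)))

/-- The integrand `f(z) g(z) weight(z) / z`. -/
def integrand (q b : ℂ) (f g : ℂ[T;T⁻¹]) (z : ℂ) : ℂ :=
  laurentEval z f * laurentEval z g * weight q b z / z

/-- The bilinear form
`⟨f,g⟩₀ = ((q³;q³)_∞ (b,b²q;q)_∞ / (b³q³;q³)_∞) ∮ f(z) g(z) weight(z) dz/(2πiz)`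
over the positively oriented unit circle. -/
def form (q b : ℂ) (f g : ℂ[T;T⁻¹]) : ℂ :=
  qPochInf (q ^ 3) (q ^ 3) * (qPochInf b q * qPochInf (b ^ 2 * q) q) /
      qPochInf (b ^ 3 * q ^ 3) (q ^ 3) *
    ((2 * Real.pi * Complex.I)⁻¹ * ∮ z in C(0, 1), integrand q b f g z)

end AskeyWilsonLaurent

end

/-!
Put `p = q³`. Since `(bz;q)_∞ = (bz, bqz, bq²z; p)_∞`, averaging the integrand over `z ↔ z⁻¹` turns
the form into Askey–Wilson functionals with base `p`: on two even-index polynomials it is the one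
with parameters `1, b, bq, bq²` (`form_pEven_pEven`); on two odd-index polynomials the factor
`(z - 1)²/(1 + z)` symmetrizes to `-(1 - z)(1 - z⁻¹)`, which moves the first parameter from `1` to
`p` (`form_pOdd_pOdd`); on polynomials of different parity the
symmetrization vanishes (`form_pEven_pOdd`).
So the theorem is the orthogonality of Askey–Wilson polynomials with first parameter `1` or `p`.
The parameter `1` lies on the contour, and the singularities it creates are removable; for this
reason the weight is written as `(z, z⁻¹; p)_k` times the regular function `awWeight`, which covers
all first parameters `p ^ k` at once.

The analytic input is one contour shift (`circleAverage_sub_mul_eq_zero`): a function that is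
holomorphic on `1 ≤ |z| ≤ 1/|p|` and invariant under `z ↦ 1/(pz)` gives no mean to `z - 1/(pz)`.
Applied to `shiftKernel` and symmetrized, it evaluates the first moment of the weight
(`circleAverage_awWeight_moment`), hence the effect on the total mass of multiplying a parameter
by `p` (`awMean_succ`, `awMean_mul_right`). Letting all parameters tend to `0` along powers of `p`
shows that the total mass is its expected product formula up to a constant (`awRatio_eq_limit`), and
the constant is read off at parameters `p, -p, √p, -√p`, where the weight is a Laurent polynomial
(`awRatio_special`, `awMean_eq`).

The same recurrences give the moments of `(az, a/z; p)_k (bz, b/z; p)_j`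
(`hasProductMoments_awFunctional`). Expanding one Askey–Wilson polynomial in the first family and
testing against the second leaves the sum `∑_k (p⁻ⁿ;p)_k p^k/(p;p)_k G(p^k)`, an iterated
`p`-difference. For `j < n` the function `G` is a polynomial of degree below `n` and the sum vanishes
(`termSum_polynomial`); for `j = n` it has a single simple pole and the sum is explicit
(`termSum_qPoch_div`). Comparison of leading coefficients gives the norms
(`functional_askeyWilson_sq`). The second family degenerates at `b = 0`; that case follows from
`b ≠ 0` by continuity in `b`.
-/

namespace AskeyWilsonLaurent

open Polynomial
open scoped LaurentPolynomial
open Filter Topology Metric Real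

/-! ### q-shifted factorials -/

@[simp] theorem qPoch_zero (a q : ℂ) : qPoch a q 0 = 1 := by simp [qPoch]

theorem qPoch_succ (a q : ℂ) (n : ℕ) : qPoch a q (n + 1) = qPoch a q n * (1 - a * q ^ n) := by
  simp [qPoch, Finset.prod_range_succ]

@[simp] theorem qPoch_one (a q : ℂ) : qPoch a q 1 = 1 - a := by simp [qPoch]

theorem qPoch_add (a q : ℂ) (m n : ℕ) :
    qPoch a q (m + n) = qPoch a q m * qPoch (a * q ^ m) q n := by
  simp only [qPoch, Finset.prod_range_add, pow_add, mul_assoc]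

theorem qPoch_succ' (a q : ℂ) (n : ℕ) : qPoch a q (n + 1) = (1 - a) * qPoch (a * q) q n := by
  rw [add_comm, qPoch_add]; simp

theorem one_sub_ne_zero_of_norm_lt_one {x : ℂ} (h : ‖x‖ < 1) : 1 - x ≠ 0 := by
  intro h0
  rw [← sub_eq_zero.1 h0] at h
  simp at h

theorem norm_mul_pow_lt_one {a q : ℂ} (ha : ‖a‖ < 1) (hq : ‖q‖ < 1) (n : ℕ) :
    ‖a * q ^ n‖ < 1 := by
  rw [norm_mul, norm_pow]
  exact (mul_le_of_le_one_right (norm_nonneg a) (pow_le_one₀ (norm_nonneg q) hq.le)).trans_lt ha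

theorem norm_mul_lt_one {a b : ℂ} (ha : ‖a‖ < 1) (hb : ‖b‖ < 1) : ‖a * b‖ < 1 := by
  simpa using norm_mul_pow_lt_one ha hb 1

theorem qPoch_ne_zero {a q : ℂ} (ha : ‖a‖ < 1) (hq : ‖q‖ < 1) (n : ℕ) : qPoch a q n ≠ 0 :=
  Finset.prod_ne_zero_iff.2 fun j _ => one_sub_ne_zero_of_norm_lt_one (norm_mul_pow_lt_one ha hq j)

/-- Dissection of a `q`-shifted factorial of length `3n` along residues modulo `3`. -/
theorem qPoch_three_mul (a q : ℂ) (n : ℕ) :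
    qPoch a q (3 * n) =
      qPoch a (q ^ 3) n * qPoch (a * q) (q ^ 3) n * qPoch (a * q ^ 2) (q ^ 3) n := by
  induction n with
  | zero => simp
  | succ n ih =>
    rw [show 3 * (n + 1) = 3 * n + 1 + 1 + 1 by ring]
    simp only [qPoch_succ, ih, pow_succ]
    ring

theorem qPoch_two_mul (a q : ℂ) (n : ℕ) :
    qPoch a q (2 * n) = qPoch a (q ^ 2) n * qPoch (a * q) (q ^ 2) n := by
  induction n with
  | zero => simp
  | succ n ih =>
    rw [show 2 * (n + 1) = 2 * n + 1 + 1 by ring]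
    simp only [qPoch_succ, ih, pow_succ]
    ring

theorem qPoch_mul_qPoch_neg (a q : ℂ) (n : ℕ) :
    qPoch a q n * qPoch (-a) q n = qPoch (a ^ 2) (q ^ 2) n := by
  induction n with
  | zero => simp
  | succ n ih =>
    simp only [qPoch_succ, ← ih]
    ring

@[simp] theorem qPochInf_zero (q : ℂ) : qPochInf 0 q = 1 := by simp [qPochInf]

theorem qPochInf_eq_qPoch_mul (a : ℂ) {q : ℂ} (hq : ‖q‖ < 1) (n : ℕ) :
    qPochInf a q = qPoch a q n * qPochInf (a * q ^ n) q := by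
  have h1 := (tendsto_qPoch a q hq).comp (tendsto_add_atTop_nat n)
  have h2 := (tendsto_qPoch (a * q ^ n) q hq).const_mul (qPoch a q n)
  refine tendsto_nhds_unique h1 (h2.congr fun m => ?_)
  rw [← qPoch_add, Function.comp_apply, add_comm]

theorem qPochInf_eq_one_sub_mul (a : ℂ) {q : ℂ} (hq : ‖q‖ < 1) :
    qPochInf a q = (1 - a) * qPochInf (a * q) q := by
  simpa using qPochInf_eq_qPoch_mul a hq 1

theorem qPochInf_ne_zero {a q : ℂ} (ha : ‖a‖ < 1) (hq : ‖q‖ < 1) : qPochInf a q ≠ 0 := by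
  have h : Summable fun j : ℕ => ‖-(a * q ^ j)‖ := by
    simpa [norm_mul, norm_pow] using (summable_geometric_of_lt_one (norm_nonneg q) hq).mul_left ‖a‖
  have h2 := tprod_one_add_ne_zero_of_summable (f := fun j : ℕ => -(a * q ^ j))
    (fun j => by
      simpa [sub_eq_add_neg] using one_sub_ne_zero_of_norm_lt_one (norm_mul_pow_lt_one ha hq j)) h
  simpa [qPochInf, sub_eq_add_neg] using h2

theorem norm_pow_lt_one {q : ℂ} (hq : ‖q‖ < 1) {n : ℕ} (hn : n ≠ 0) : ‖q ^ n‖ < 1 := by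
  rw [norm_pow]
  exact pow_lt_one₀ (norm_nonneg q) hq hn

theorem qPochInf_dissect_three (a : ℂ) {q : ℂ} (hq : ‖q‖ < 1) :
    qPochInf a q =
      qPochInf a (q ^ 3) * qPochInf (a * q) (q ^ 3) * qPochInf (a * q ^ 2) (q ^ 3) := by
  have h3 : ‖q ^ 3‖ < 1 := norm_pow_lt_one hq (by norm_num)
  have h1 := (tendsto_qPoch a q hq).comp
    (tendsto_id.const_mul_atTop' (by norm_num : 0 < 3))
  exact tendsto_nhds_unique h1
    ((((tendsto_qPoch a _ h3).mul (tendsto_qPoch (a * q) _ h3)).mul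
      (tendsto_qPoch (a * q ^ 2) _ h3)).congr fun n => (qPoch_three_mul a q n).symm)

theorem qPochInf_dissect_two (a : ℂ) {q : ℂ} (hq : ‖q‖ < 1) :
    qPochInf a q = qPochInf a (q ^ 2) * qPochInf (a * q) (q ^ 2) := by
  have h2 : ‖q ^ 2‖ < 1 := norm_pow_lt_one hq (by norm_num)
  have h1 := (tendsto_qPoch a q hq).comp
    (tendsto_id.const_mul_atTop' (by norm_num : 0 < 2))
  exact tendsto_nhds_unique h1
    (((tendsto_qPoch a _ h2).mul (tendsto_qPoch (a * q) _ h2)).congr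
      fun n => (qPoch_two_mul a q n).symm)

theorem qPochInf_mul_qPochInf_neg (a : ℂ) {q : ℂ} (hq : ‖q‖ < 1) :
    qPochInf a q * qPochInf (-a) q = qPochInf (a ^ 2) (q ^ 2) :=
  tendsto_nhds_unique
    (((tendsto_qPoch a q hq).mul (tendsto_qPoch (-a) q hq)).congr fun n => qPoch_mul_qPoch_neg a q n)
    (tendsto_qPoch _ _ (norm_pow_lt_one hq (by norm_num)))

/-- Euler's identity `(-q;q)_∞ (q;q²)_∞ = 1`. -/
theorem euler_odd_distinct {q : ℂ} (hq : ‖q‖ < 1) :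
    qPochInf (-q) q * qPochInf q (q ^ 2) = 1 := by
  have h2 : ‖q ^ 2‖ < 1 := norm_pow_lt_one hq (by norm_num)
  have h1 := qPochInf_mul_qPochInf_neg q hq
  have h3 := qPochInf_dissect_two q hq
  rw [← sq] at h3
  have h4 : qPochInf (q ^ 2) (q ^ 2) ≠ 0 := qPochInf_ne_zero h2 h2
  rw [h3] at h1
  refine mul_right_cancel₀ h4 ?_
  linear_combination h1

/-- `(a;q)_∞` is an entire function of `a`. -/
theorem differentiable_qPochInf {q : ℂ} (hq : ‖q‖ < 1) :
    Differentiable ℂ fun a => qPochInf a q := by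
  have key : ∀ R : ℝ, DifferentiableOn ℂ (fun a => qPochInf a q) (ball 0 R) := by
    intro R
    have h : HasProdLocallyUniformlyOn (fun (n : ℕ) (a : ℂ) => 1 + -(a * q ^ n))
        (fun a => ∏' n : ℕ, (1 + -(a * q ^ n))) (ball 0 R) := by
      refine Summable.hasProdLocallyUniformlyOn_nat_one_add isOpen_ball
        (u := fun n => R * ‖q‖ ^ n)
        ((summable_geometric_of_lt_one (norm_nonneg q) hq).mul_left R)
        (.of_forall fun n a ha => ?_) (fun n => by fun_prop)
      rw [norm_neg, norm_mul, norm_pow]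
      have : ‖a‖ < R := by simpa using ha
      gcongr
    have h2 := h.differentiableOn (.of_forall fun s => by
      simpa [Finset.prod_fn] using DifferentiableOn.finsetProd (fun _ _ => by fun_prop)) isOpen_ball
    simpa [qPochInf, sub_eq_add_neg] using h2
  intro a
  exact (key (‖a‖ + 1)).differentiableAt (isOpen_ball.mem_nhds (by simp))

theorem continuous_qPochInf {q : ℂ} (hq : ‖q‖ < 1) : Continuous fun a => qPochInf a q :=
  (differentiable_qPochInf hq).continuous

/-! ### Circle averages -/

theorem circleAverage_eq_of_differentiable_annulus {G : ℂ → ℂ} {R : ℝ} (hR : 1 ≤ R)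
    (hd : ∀ z, 1 ≤ ‖z‖ → ‖z‖ ≤ R → DifferentiableAt ℂ G z) :
    circleAverage G 0 R = circleAverage G 0 1 := by
  have hR0 : R ≠ 0 := by positivity
  rw [circleAverage_eq_circleIntegral hR0, circleAverage_eq_circleIntegral one_ne_zero,
    Complex.circleIntegral_sub_center_inv_smul_eq_of_differentiable_on_annulus_off_countable
      one_pos hR Set.countable_empty]
  · intro z hz
    simp only [Set.mem_sdiff, mem_closedBall, dist_zero_right, mem_ball, not_lt] at hz
    exact (hd z hz.2 hz.1).continuousAt.continuousWithinAt
  · intro z hz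
    simp only [Set.mem_sdiff, mem_closedBall, dist_zero_right, mem_ball, not_le] at hz
    exact hd z hz.1.2.le hz.1.1.le

/-- Scaling the variable by a complex number scales the radius by its modulus. -/
theorem circleAverage_comp_mul (G : ℂ → ℂ) (c : ℂ) :
    circleAverage (fun z => G (c * z)) 0 1 = circleAverage G 0 ‖c‖ := by
  rw [circleAverage_eq_integral_add (f := G) (Complex.arg c), circleAverage_def]
  congr 2 with θ
  congr 1
  simp only [circleMap, zero_add, Complex.ofReal_one, one_mul, Complex.ofReal_add, add_mul,
    Complex.exp_add]
  conv_lhs => rw [← Complex.norm_mul_exp_arg_mul_I c]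
  ring

/-- If `Θ` is holomorphic on the annulus `1 ≤ |z| ≤ 1/|p|` and invariant under its inversion
`z ↦ 1/(pz)`, then `zΘ(z)` and `Θ(z)/(pz)` have the same mean over the unit circle: the contour of
the first can be moved to the outer boundary, which the inversion maps back to the unit circle. -/
theorem circleAverage_sub_mul_eq_zero {p : ℂ} (hp0 : p ≠ 0) (hp : ‖p‖ < 1) {Θ : ℂ → ℂ}
    (hd : ∀ z, 1 ≤ ‖z‖ → ‖z‖ ≤ ‖p‖⁻¹ → DifferentiableAt ℂ Θ z)
    (hs : ∀ z, ‖z‖ = 1 → Θ (p * z)⁻¹ = Θ z) :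
    circleAverage (fun z => (z - (p * z)⁻¹) * Θ z) 0 1 = 0 := by
  have hR : 1 ≤ ‖p‖⁻¹ := (one_le_inv₀ (norm_pos_iff.2 hp0)).2 hp.le
  have hc : ContinuousOn Θ (sphere 0 1) := fun z hz => by
    have hz1 : ‖z‖ = 1 := by simpa using hz
    exact (hd z hz1.ge (hz1.le.trans hR)).continuousAt.continuousWithinAt
  have h1 : circleAverage (fun z => z * Θ z) 0 1 = circleAverage (fun z => (p * z)⁻¹ * Θ z) 0 1 := by
    rw [← circleAverage_eq_of_differentiable_annulus hR (G := fun z => z * Θ z)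
        fun z h1 h2 => differentiableAt_id.mul (hd z h1 h2),
      ← norm_inv, ← circleAverage_comp_mul (fun z => z * Θ z) p⁻¹,
      ← circleAverage_zero_one_congr_inv]
    refine circleAverage_congr_sphere fun z hz => ?_
    have hz1 : ‖z‖ = 1 := by simpa using hz
    simp only [← mul_inv, hs z hz1]
  have hne : ∀ z ∈ sphere (0 : ℂ) 1, z ≠ 0 := fun z hz => ne_of_mem_sphere hz one_ne_zero
  have hi1 : CircleIntegrable (fun z => z * Θ z) 0 1 :=
    (continuousOn_id.mul hc).circleIntegrable zero_le_one
  have hi2 : CircleIntegrable (fun z => (p * z)⁻¹ * Θ z) 0 1 :=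
    (((continuousOn_const.mul continuousOn_id).inv₀
      fun z hz => mul_ne_zero hp0 (hne z hz)).mul hc).circleIntegrable zero_le_one
  simp only [sub_mul]
  rw [circleAverage_fun_sub hi1 hi2, h1, sub_self]

/-- The mean over the unit circle may be computed after symmetrizing in `z ↔ z⁻¹`. -/
theorem two_mul_circleAverage {F : ℂ → ℂ} (hF : ContinuousOn F (sphere 0 1)) :
    2 * circleAverage F 0 1 = circleAverage (fun z => F z + F z⁻¹) 0 1 := by
  have hinv : ContinuousOn (fun z => F z⁻¹) (sphere (0 : ℂ) 1) := by
    refine hF.comp (continuousOn_inv₀.mono fun z hz => ne_of_mem_sphere hz one_ne_zero) ?_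
    intro z hz
    simpa using hz
  rw [circleAverage_fun_add (hF.circleIntegrable zero_le_one) (hinv.circleIntegrable zero_le_one),
    circleAverage_zero_one_congr_inv (f := F), two_mul]

theorem circleAverage_const_mul (a : ℂ) (F : ℂ → ℂ) :
    circleAverage (fun z => a * F z) 0 1 = a * circleAverage F 0 1 := by
  simpa using circleAverage_fun_smul (a := a) (f := F) (c := 0) (R := 1)

/-- Means over the unit circle depend continuously on parameters. -/
theorem continuousOn_circleAverage {X : Type*} [TopologicalSpace X] {F : X → ℂ → ℂ}
    {s : Set X} (hF : ContinuousOn (fun x : X × ℂ => F x.1 x.2) (s ×ˢ sphere 0 1)) :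
    ContinuousOn (fun x => circleAverage (F x) 0 1) s := by
  rw [continuousOn_iff_continuous_domRestrict] at *
  apply (intervalIntegral.continuous_parametric_intervalIntegral_of_continuous' _ _ _).const_smul
  have (x : s × ℝ) : ((x.1 : X), circleMap 0 1 x.2) ∈ s ×ˢ sphere (0 : ℂ) 1 := by
    simp
  apply hF.comp (f := (fun x ↦ ⟨_, this x⟩))
  fun_prop

/-! ### The Askey–Wilson weight and its contour relation -/

/-- The product `(tz, t/z; p)_∞`. -/
noncomputable def pairInf (p t z : ℂ) : ℂ := qPochInf (t * z) p * qPochInf (t * z⁻¹) p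

/-- The product `(tz, t/z; p)_k`. -/
noncomputable def pairPoch (p t z : ℂ) (k : ℕ) : ℂ := qPoch (t * z) p k * qPoch (t * z⁻¹) p k

/-- The product
`(pz², p/z²; p)_∞ / (az, a/z, bz, b/z, cz, c/z, dz, d/z; p)_∞`: the Askey–Wilson weight without its
factor `(1 - z²)(1 - z⁻²)`. -/
noncomputable def core (p a b c d z : ℂ) : ℂ :=
  qPochInf (p * z ^ 2) p * qPochInf (p * z⁻¹ ^ 2) p /
    (pairInf p a z * pairInf p b z * pairInf p c z * pairInf p d z)

/-- The Askey–Wilson weight `(z², z⁻²; p)_∞ / (z, 1/z, bz, b/z, cz, c/z, dz, d/z; p)_∞` with first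
parameter `1`, with its removable singularities at `z = ±1` removed. Multiplication by
`(z, 1/z; p)_k` turns it into the weight with first parameter `p ^ k`. -/
noncomputable def awWeight (p b c d z : ℂ) : ℂ := (1 + z) * (1 + z⁻¹) * core p p b c d z

theorem pairInf_inv (p t z : ℂ) : pairInf p t z⁻¹ = pairInf p t z := by
  simp [pairInf, mul_comm]

theorem core_inv (p a b c d z : ℂ) : core p a b c d z⁻¹ = core p a b c d z := by
  simp only [core, pairInf_inv, inv_inv, mul_comm (qPochInf (p * z⁻¹ ^ 2) p)]

theorem pairInf_ne_zero {p t z : ℂ} (hp : ‖p‖ < 1) (ht : ‖t‖ < 1) (hz : ‖z‖ = 1) :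
    pairInf p t z ≠ 0 :=
  mul_ne_zero (qPochInf_ne_zero (by simpa [hz] using ht) hp)
    (qPochInf_ne_zero (by simpa [hz] using ht) hp)

@[simp] theorem pairPoch_zero (p t z : ℂ) : pairPoch p t z 0 = 1 := by simp [pairPoch]

theorem pairPoch_succ (p t z : ℂ) (k : ℕ) :
    pairPoch p t z (k + 1) =
      pairPoch p t z k * ((1 - t * p ^ k * z) * (1 - t * p ^ k * z⁻¹)) := by
  simp only [pairPoch, qPoch_succ]; ring

theorem pairInf_eq_mul {p : ℂ} (hp : ‖p‖ < 1) (t z : ℂ) :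
    pairInf p t z = (1 - t * z) * (1 - t * z⁻¹) * pairInf p (t * p) z := by
  rw [pairInf, qPochInf_eq_one_sub_mul _ hp, qPochInf_eq_one_sub_mul (t * z⁻¹) hp, pairInf]
  ring_nf

theorem continuousOn_pairInf {X : Type*} [TopologicalSpace X] {s : Set X} {p : ℂ} (hp : ‖p‖ < 1)
    {T Z : X → ℂ} (hT : ContinuousOn T s) (hZ : ContinuousOn Z s) (hZ1 : ∀ x ∈ s, ‖Z x‖ = 1) :
    ContinuousOn (fun x => pairInf p (T x) (Z x)) s := by
  have hi : ContinuousOn (fun x => (Z x)⁻¹) s :=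
    hZ.inv₀ fun x hx h => by simpa [h] using hZ1 x hx
  have hc := continuous_qPochInf hp
  exact (hc.comp_continuousOn (hT.mul hZ)).mul (hc.comp_continuousOn (hT.mul hi))

theorem continuousOn_core {X : Type*} [TopologicalSpace X] {s : Set X} {p : ℂ} (hp : ‖p‖ < 1)
    {A B C D Z : X → ℂ} (hA : ContinuousOn A s) (hB : ContinuousOn B s) (hC : ContinuousOn C s) (hD : ContinuousOn D s)
    (hZ : ContinuousOn Z s) (hA1 : ∀ x ∈ s, ‖A x‖ < 1) (hB1 : ∀ x ∈ s, ‖B x‖ < 1) (hC1 : ∀ x ∈ s, ‖C x‖ < 1)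
    (hD1 : ∀ x ∈ s, ‖D x‖ < 1) (hZ1 : ∀ x ∈ s, ‖Z x‖ = 1) :
    ContinuousOn (fun x => core p (A x) (B x) (C x) (D x) (Z x)) s := by
  have hi : ContinuousOn (fun x => (Z x)⁻¹) s :=
    hZ.inv₀ fun x hx h => by simpa [h] using hZ1 x hx
  have hc := continuous_qPochInf hp
  refine ContinuousOn.div ?_ ?_ fun x hx => ?_
  · exact (hc.comp_continuousOn (continuousOn_const.mul (hZ.pow 2))).mul
      (hc.comp_continuousOn (continuousOn_const.mul (hi.pow 2)))
  · exact (((continuousOn_pairInf hp hA hZ hZ1).mul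
      (continuousOn_pairInf hp hB hZ hZ1)).mul (continuousOn_pairInf hp hC hZ hZ1)).mul
      (continuousOn_pairInf hp hD hZ hZ1)
  · exact mul_ne_zero (mul_ne_zero (mul_ne_zero (pairInf_ne_zero hp (hA1 x hx) (hZ1 x hx))
      (pairInf_ne_zero hp (hB1 x hx) (hZ1 x hx))) (pairInf_ne_zero hp (hC1 x hx) (hZ1 x hx)))
      (pairInf_ne_zero hp (hD1 x hx) (hZ1 x hx))

theorem continuousOn_inv_sphere : ContinuousOn (fun z : ℂ => z⁻¹) (sphere 0 1) :=
  continuousOn_inv₀.mono fun _ hz => ne_of_mem_sphere hz one_ne_zero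

theorem continuousOn_core_sphere {p b c d : ℂ} (hp : ‖p‖ < 1) (hb : ‖b‖ < 1) (hc : ‖c‖ < 1)
    (hd : ‖d‖ < 1) : ContinuousOn (core p p b c d) (sphere 0 1) :=
  continuousOn_core hp continuousOn_const continuousOn_const continuousOn_const continuousOn_const continuousOn_id
    (fun _ _ => hp) (fun _ _ => hb) (fun _ _ => hc) (fun _ _ => hd) (fun z hz => by simpa using hz)

theorem continuousOn_awWeight {p b c d : ℂ} (hp : ‖p‖ < 1) (hb : ‖b‖ < 1) (hc : ‖c‖ < 1)
    (hd : ‖d‖ < 1) : ContinuousOn (awWeight p b c d) (sphere 0 1) := by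
  have := continuousOn_inv_sphere
  exact ((continuousOn_const.add continuousOn_id).mul (continuousOn_const.add this)).mul
    (continuousOn_core_sphere hp hb hc hd)

theorem continuousOn_pairPoch (p t : ℂ) (k : ℕ) :
    ContinuousOn (fun z => pairPoch p t z k) (sphere 0 1) := by
  have := continuousOn_inv_sphere
  unfold pairPoch qPoch
  fun_prop

/-- The kernel moved across the annulus `1 ≤ |z| ≤ 1/|p|`. On the unit circle it is, up to the
factor `(1 - p z²)(1 + z)/∏ (1 - t z)`, the weight with first parameter `p ^ k`. -/
noncomputable def shiftKernel (p b c d : ℂ) (k : ℕ) (z : ℂ) : ℂ :=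
  (1 + p * z) * (1 + z⁻¹) * (qPochInf (p ^ 3 * z ^ 2) p * qPochInf (p * z⁻¹ ^ 2) p) *
      (qPoch (p * z) p k * qPoch z⁻¹ p k) /
    (qPochInf (p ^ 2 * z) p * qPochInf (p * z⁻¹) p *
      (qPochInf (b * p * z) p * qPochInf (b * z⁻¹) p) *
      (qPochInf (c * p * z) p * qPochInf (c * z⁻¹) p) *
      (qPochInf (d * p * z) p * qPochInf (d * z⁻¹) p))

theorem shiftKernel_symm {p : ℂ} (hp0 : p ≠ 0) (b c d : ℂ) (k : ℕ) {z : ℂ} (hz : z ≠ 0) :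
    shiftKernel p b c d k (p * z)⁻¹ = shiftKernel p b c d k z := by
  have e1 : p * (p * z)⁻¹ = z⁻¹ := by field_simp
  have e2 : p ^ 3 * (p * z)⁻¹ ^ 2 = p * z⁻¹ ^ 2 := by field_simp
  have e3 : p * (p * z) ^ 2 = p ^ 3 * z ^ 2 := by ring
  have e4 : p ^ 2 * (p * z)⁻¹ = p * z⁻¹ := by field_simp
  have e5 : p * (p * z) = p ^ 2 * z := by ring
  have e6 (t : ℂ) : t * p * (p * z)⁻¹ = t * z⁻¹ := by field_simp
  have e7 (t : ℂ) : t * (p * z) = t * p * z := by ring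
  simp only [shiftKernel, e1, e2, e4, e6, inv_inv]
  rw [e3, e5, e7 b, e7 c, e7 d]
  ring

theorem differentiableAt_shiftKernel {p b c d : ℂ} (hp : ‖p‖ < 1)
    (hb : ‖b‖ < 1) (hc : ‖c‖ < 1) (hd : ‖d‖ < 1) (k : ℕ) {z : ℂ} (h1 : 1 ≤ ‖z‖)
    (h2 : ‖p‖ * ‖z‖ ≤ 1) : DifferentiableAt ℂ (shiftKernel p b c d k) z := by
  have hz : z ≠ 0 := norm_pos_iff.1 (zero_lt_one.trans_le h1)
  have hq := differentiable_qPochInf hp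
  have hin {t : ℂ} (ht : ‖t‖ < 1) : qPochInf (t * z⁻¹) p ≠ 0 := by
    refine qPochInf_ne_zero ?_ hp
    rw [norm_mul, norm_inv]
    exact (mul_le_of_le_one_right (norm_nonneg t) (inv_le_one_of_one_le₀ h1)).trans_lt ht
  have hout {t : ℂ} (ht : ‖t‖ < 1) : qPochInf (t * p * z) p ≠ 0 := by
    refine qPochInf_ne_zero ?_ hp
    rw [mul_assoc, norm_mul, norm_mul p]
    exact (mul_le_of_le_one_right (norm_nonneg t) h2).trans_lt ht
  have hcomp {f : ℂ → ℂ} (hf : DifferentiableAt ℂ f z) :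
      DifferentiableAt ℂ (fun y => qPochInf (f y) p) z := (hq (f z)).comp z hf
  have hi : DifferentiableAt ℂ (fun y : ℂ => y⁻¹) z := differentiableAt_inv hz
  have hPoch {f : ℂ → ℂ} (hf : DifferentiableAt ℂ f z) :
      DifferentiableAt ℂ (fun y => qPoch (f y) p k) z := by
    unfold qPoch
    fun_prop
  have hpp : qPochInf (p ^ 2 * z) p ≠ 0 := by simpa [sq] using hout hp
  unfold shiftKernel
  refine DifferentiableAt.div ?_ ?_ ?_
  · exact (((by fun_prop : DifferentiableAt ℂ (fun y => 1 + p * y) z).mul (hi.const_add 1)).mul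
      ((hcomp (by fun_prop)).mul (hcomp (by fun_prop)))).mul
      ((hPoch (by fun_prop)).mul (hPoch hi))
  · exact ((((hcomp (by fun_prop)).mul (hcomp (hi.const_mul p))).mul
      ((hcomp (by fun_prop)).mul (hcomp (hi.const_mul b)))).mul
      ((hcomp (by fun_prop)).mul (hcomp (hi.const_mul c)))).mul
      ((hcomp (by fun_prop)).mul (hcomp (hi.const_mul d)))
  · have := hin hp; have := hin hb; have := hin hc; have := hin hd
    have := hout hb; have := hout hc; have := hout hd
    simp [*]

/-- On the unit circle the shifted kernel is the common factor `core` times a Laurent polynomial. -/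
theorem sub_mul_shiftKernel {p b c d : ℂ} (hp0 : p ≠ 0) (hp : ‖p‖ < 1)
    (hb : ‖b‖ < 1) (hc : ‖c‖ < 1) (hd : ‖d‖ < 1) (k : ℕ) {z : ℂ} (hz : ‖z‖ = 1) :
    (z - (p * z)⁻¹) * shiftKernel p b c d k z =
      -p⁻¹ * (z⁻¹ * (1 + z⁻¹) * (qPoch (p * z) p k * qPoch z⁻¹ p k) *
        ((1 - b * z) * (1 - c * z) * (1 - d * z)) * core p p b c d z) := by
  have hz0 : z ≠ 0 := norm_pos_iff.1 (by simp [hz])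
  have hn {t : ℂ} (ht : ‖t‖ < 1) : ‖t * z‖ < 1 := by simpa [hz] using ht
  have hne {t : ℂ} (ht : ‖t‖ < 1) : 1 - t * z ≠ 0 := one_sub_ne_zero_of_norm_lt_one (hn ht)
  have hne1 {t : ℂ} (ht : ‖t‖ < 1) : qPochInf (t * p * z) p ≠ 0 :=
    qPochInf_ne_zero (hn (norm_mul_lt_one ht hp)) hp
  have hne2 {t : ℂ} (ht : ‖t‖ < 1) : qPochInf (t * z⁻¹) p ≠ 0 :=
    qPochInf_ne_zero (by simpa [hz] using ht) hp
  have e (t : ℂ) : qPochInf (t * z) p = (1 - t * z) * qPochInf (t * p * z) p := by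
    rw [qPochInf_eq_one_sub_mul _ hp, mul_right_comm]
  have e2 : qPochInf (p * z ^ 2) p =
      (1 - p * z ^ 2) * ((1 - p * z) * (1 + p * z)) * qPochInf (p ^ 3 * z ^ 2) p := by
    rw [qPochInf_eq_one_sub_mul _ hp, qPochInf_eq_one_sub_mul _ hp]
    ring_nf
  unfold shiftKernel core pairInf
  rw [e2, e b, e c, e d, e p, sq p]
  have n1 := hne hp; have n2 := hne hb; have n3 := hne hc; have n4 := hne hd
  have m1 := hne1 hp; have m2 := hne1 hb; have m3 := hne1 hc; have m4 := hne1 hd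
  have l1 := hne2 hp; have l2 := hne2 hb; have l3 := hne2 hc; have l4 := hne2 hd
  generalize qPochInf (p * p * z) p = A1 at *
  generalize qPochInf (b * p * z) p = A2 at *
  generalize qPochInf (c * p * z) p = A3 at *
  generalize qPochInf (d * p * z) p = A4 at *
  generalize qPochInf (p * z⁻¹) p = B1 at *
  generalize qPochInf (b * z⁻¹) p = B2 at *
  generalize qPochInf (c * z⁻¹) p = B3 at *
  generalize qPochInf (d * z⁻¹) p = B4 at *
  generalize qPochInf (p * z⁻¹ ^ 2) p = F1
  generalize qPochInf (p ^ 3 * z ^ 2) p = F2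
  generalize qPoch (p * z) p k = F3
  generalize qPoch z⁻¹ p k = F4
  generalize 1 - p * z = D1 at *
  generalize 1 - b * z = D2 at *
  generalize 1 - c * z = D3 at *
  generalize 1 - d * z = D4 at *
  field_simp
  ring

/-- The symmetrization of the kernel under `z ↔ z⁻¹`, in which only the first moment
`(1 - e₄)(z + z⁻¹) - (e₁ - e₃)` survives, `eᵢ` being the elementary symmetric functions of
`p ^ k, b, c, d`. -/
theorem shiftKernel_symmetrize (p b c d : ℂ) (k : ℕ) {z : ℂ} (hz0 : z ≠ 0) :
    z⁻¹ * (1 + z⁻¹) * (qPoch (p * z) p k * qPoch z⁻¹ p k) *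
        ((1 - b * z) * (1 - c * z) * (1 - d * z)) +
      z * (1 + z) * (qPoch (p * z⁻¹) p k * qPoch z p k) *
        ((1 - b * z⁻¹) * (1 - c * z⁻¹) * (1 - d * z⁻¹)) =
      pairPoch p 1 z k * ((1 + z) * (1 + z⁻¹)) * ((1 - p ^ k * b * c * d) * (z + z⁻¹) -
        (p ^ k + b + c + d - (p ^ k * b * c + p ^ k * b * d + p ^ k * c * d + b * c * d))) := by
  cases k with
  | zero =>
    simp only [qPoch_zero, pairPoch_zero, pow_zero]
    field_simp
    ring
  | succ k =>
    simp only [pairPoch, one_mul]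
    rw [qPoch_succ' z, qPoch_succ' z⁻¹, qPoch_succ (p * z), qPoch_succ (p * z⁻¹), mul_comm z p,
      mul_comm z⁻¹ p]
    generalize qPoch (p * z) p k = F
    generalize qPoch (p * z⁻¹) p k = G
    rw [pow_succ]
    generalize p ^ k = P
    field_simp
    ring

/-- The first moment of the weight with parameters `p ^ k, b, c, d`. -/
theorem circleAverage_awWeight_moment {p b c d : ℂ} (hp0 : p ≠ 0) (hp : ‖p‖ < 1)
    (hb : ‖b‖ < 1) (hc : ‖c‖ < 1) (hd : ‖d‖ < 1) (k : ℕ) :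
    circleAverage (fun z => pairPoch p 1 z k * awWeight p b c d z *
      ((1 - p ^ k * b * c * d) * (z + z⁻¹) -
        (p ^ k + b + c + d - (p ^ k * b * c + p ^ k * b * d + p ^ k * c * d + b * c * d)))) 0 1
      = 0 := by
  have hp1 : 0 < ‖p‖ := norm_pos_iff.2 hp0
  have hdiff : ∀ z, 1 ≤ ‖z‖ → ‖z‖ ≤ ‖p‖⁻¹ → DifferentiableAt ℂ (shiftKernel p b c d k) z :=
    fun z h1 h2 => differentiableAt_shiftKernel hp hb hc hd k h1 (by
      rwa [mul_comm, ← le_div_iff₀ hp1, one_div])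
  have h0 := circleAverage_sub_mul_eq_zero hp0 hp hdiff fun z hz =>
    shiftKernel_symm hp0 b c d k (norm_pos_iff.1 (by simp [hz]))
  have hcont : ContinuousOn (fun z => (z - (p * z)⁻¹) * shiftKernel p b c d k z)
      (sphere 0 1) := by
    intro z hz
    have hz1 : ‖z‖ = 1 := by simpa using hz
    have hz0 : z ≠ 0 := norm_pos_iff.1 (by simp [hz1])
    have h1 := (hdiff z hz1.ge (hz1.le.trans ((one_le_inv₀ hp1).2 hp.le))).continuousAt
    have h2 : ContinuousAt (fun z => (z - (p * z)⁻¹)) z :=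
      ContinuousAt.sub (by fun_prop) (ContinuousAt.inv₀ (by fun_prop) (mul_ne_zero hp0 hz0))
    exact (h2.mul h1).continuousWithinAt
  have h2 := two_mul_circleAverage hcont
  rw [h0, mul_zero] at h2
  have h3 : circleAverage (fun z => -p⁻¹ * (pairPoch p 1 z k * awWeight p b c d z *
      ((1 - p ^ k * b * c * d) * (z + z⁻¹) -
        (p ^ k + b + c + d - (p ^ k * b * c + p ^ k * b * d + p ^ k * c * d + b * c * d))))) 0 1
      = 0 := by
    refine Eq.trans (circleAverage_congr_sphere fun z hz => ?_) h2.symm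
    have hz1 : ‖z‖ = 1 := by simpa using hz
    have hz0 : z ≠ 0 := norm_pos_iff.1 (by simp [hz1])
    have h4 := shiftKernel_symmetrize p b c d k hz0
    simp only [sub_mul_shiftKernel hp0 hp hb hc hd k hz1,
      sub_mul_shiftKernel hp0 hp hb hc hd k (z := z⁻¹) (by simp [hz1]), core_inv, inv_inv, awWeight]
    linear_combination (p⁻¹ * core p p b c d z) * h4
  rw [circleAverage_const_mul] at h3
  exact (mul_eq_zero.1 h3).resolve_left (neg_ne_zero.2 (inv_ne_zero hp0))

/-! ### Evaluation of the Askey–Wilson integral -/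

/-- The total mass of the weight with parameters `p ^ k, b, c, d`. -/
noncomputable def awMean (p : ℂ) (k : ℕ) (b c d : ℂ) : ℂ :=
  circleAverage (fun z => pairPoch p 1 z k * awWeight p b c d z) 0 1

theorem awWeight_swap₁₂ (p b c d z : ℂ) : awWeight p b c d z = awWeight p c b d z := by
  simp only [awWeight, core, mul_right_comm _ (pairInf p b z) (pairInf p c z)]

theorem awWeight_swap₁₃ (p b c d z : ℂ) : awWeight p b c d z = awWeight p d c b z := by
  simp only [awWeight, core]
  ring_nf

theorem awMean_swap₁₂ (p : ℂ) (k : ℕ) (b c d : ℂ) : awMean p k b c d = awMean p k c b d := by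
  simp only [awMean, awWeight_swap₁₂ p b c d]

theorem awMean_swap₁₃ (p : ℂ) (k : ℕ) (b c d : ℂ) : awMean p k b c d = awMean p k d c b := by
  simp only [awMean, awWeight_swap₁₃ p b c d]

theorem awWeight_mul_right {p b c d z : ℂ} (hp : ‖p‖ < 1) (hb : ‖b‖ < 1) (hz : ‖z‖ = 1) :
    awWeight p (b * p) c d z = awWeight p b c d z * ((1 - b * z) * (1 - b * z⁻¹)) := by
  have h1 : 1 - b * z ≠ 0 := one_sub_ne_zero_of_norm_lt_one (by simpa [hz] using hb)
  have h2 : 1 - b * z⁻¹ ≠ 0 := one_sub_ne_zero_of_norm_lt_one (by simpa [hz] using hb)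
  rw [awWeight, awWeight, core, core, pairInf_eq_mul hp b]
  generalize 1 - b * z = D1 at *
  generalize 1 - b * z⁻¹ = D2 at *
  field_simp

theorem continuousOn_pairPoch_mul_awWeight {p b c d : ℂ} (hp : ‖p‖ < 1) (hb : ‖b‖ < 1)
    (hc : ‖c‖ < 1) (hd : ‖d‖ < 1) (t : ℂ) (k : ℕ) :
    ContinuousOn (fun z => pairPoch p t z k * awWeight p b c d z) (sphere 0 1) :=
  (continuousOn_pairPoch p t k).mul (continuousOn_awWeight hp hb hc hd)

/-- If the first moment of a weight vanishes against `A (z + z⁻¹) - B`, then the mass of the weight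
times `(1 - tz)(1 - t/z)` is a multiple of the mass of the weight. -/
theorem circleAverage_mul_quadratic {F : ℂ → ℂ} {A B : ℂ} (hF : ContinuousOn F (sphere 0 1))
    (h : circleAverage (fun z => F z * (A * (z + z⁻¹) - B)) 0 1 = 0) (t : ℂ) :
    A * circleAverage (fun z => F z * ((1 - t * z) * (1 - t * z⁻¹))) 0 1 =
      (A * (1 + t ^ 2) - t * B) * circleAverage F 0 1 := by
  have hi := continuousOn_inv_sphere
  have c1 : CircleIntegrable (fun z => (A * (1 + t ^ 2) - t * B) * F z) 0 1 :=
    (continuousOn_const.mul hF).circleIntegrable zero_le_one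
  have c2 : CircleIntegrable (fun z => t * (F z * (A * (z + z⁻¹) - B))) 0 1 :=
    ContinuousOn.circleIntegrable zero_le_one (by fun_prop)
  have h0 : circleAverage (fun z => t * (F z * (A * (z + z⁻¹) - B))) 0 1 = 0 := by
    rw [circleAverage_const_mul, h, mul_zero]
  rw [← circleAverage_const_mul, ← circleAverage_const_mul,
    ← sub_zero (circleAverage (fun z => (A * (1 + t ^ 2) - t * B) * F z) 0 1)]
  refine Eq.trans ?_ (congrArg _ h0)
  rw [← circleAverage_fun_sub c1 c2]
  refine circleAverage_congr_sphere fun z hz => ?_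
  have hz0 : z ≠ 0 := norm_pos_iff.1 (by
    have : ‖z‖ = 1 := by simpa using hz
    simp [this])
  have hzi : z * z⁻¹ = 1 := mul_inv_cancel₀ hz0
  linear_combination (A * F z * t ^ 2) * hzi

theorem awMean_quadratic {p b c d : ℂ} (hp0 : p ≠ 0) (hp : ‖p‖ < 1) (hb : ‖b‖ < 1) (hc : ‖c‖ < 1)
    (hd : ‖d‖ < 1) (k : ℕ) (t : ℂ) :
    (1 - p ^ k * b * c * d) * circleAverage (fun z => pairPoch p 1 z k * awWeight p b c d z *
        ((1 - t * z) * (1 - t * z⁻¹))) 0 1 =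
      ((1 - p ^ k * b * c * d) * (1 + t ^ 2) - t *
        (p ^ k + b + c + d - (p ^ k * b * c + p ^ k * b * d + p ^ k * c * d + b * c * d))) *
        awMean p k b c d :=
  circleAverage_mul_quadratic (continuousOn_pairPoch_mul_awWeight hp hb hc hd 1 k)
    (circleAverage_awWeight_moment hp0 hp hb hc hd k) t

/-- Multiplying the first parameter `p ^ k` by `p` multiplies the weight by
`(1 - p ^ k z)(1 - p ^ k / z)`, whose mean the first moment determines. -/
theorem awMean_succ {p b c d : ℂ} (hp0 : p ≠ 0) (hp : ‖p‖ < 1) (hb : ‖b‖ < 1) (hc : ‖c‖ < 1)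
    (hd : ‖d‖ < 1) (k : ℕ) :
    (1 - p ^ k * b * c * d) * awMean p (k + 1) b c d =
      (1 - p ^ k * b) * (1 - p ^ k * c) * (1 - p ^ k * d) * awMean p k b c d := by
  have h := awMean_quadratic hp0 hp hb hc hd k (p ^ k)
  have h2 : awMean p (k + 1) b c d = circleAverage (fun z => pairPoch p 1 z k *
      awWeight p b c d z * ((1 - p ^ k * z) * (1 - p ^ k * z⁻¹))) 0 1 := by
    rw [awMean]
    congr 1 with z
    rw [pairPoch_succ]
    ring
  rw [h2, h]
  ring

theorem awMean_mul_right {p b c d : ℂ} (hp0 : p ≠ 0) (hp : ‖p‖ < 1) (hb : ‖b‖ < 1) (hc : ‖c‖ < 1)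
    (hd : ‖d‖ < 1) (k : ℕ) :
    (1 - p ^ k * b * c * d) * awMean p k (b * p) c d =
      (1 - p ^ k * b) * (1 - b * c) * (1 - b * d) * awMean p k b c d := by
  have h := awMean_quadratic hp0 hp hb hc hd k b
  have h2 : awMean p k (b * p) c d = circleAverage (fun z => pairPoch p 1 z k *
      awWeight p b c d z * ((1 - b * z) * (1 - b * z⁻¹))) 0 1 := by
    refine circleAverage_congr_sphere fun z hz => ?_
    have hz1 : ‖z‖ = 1 := by simpa using hz
    simp only [awWeight_mul_right hp hb hz1]
    ring
  rw [h2, h]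
  ring

/-- The total mass divided by its expected closed form (up to a constant); it is invariant under
multiplying any of the four parameters by `p`. -/
noncomputable def awRatio (p : ℂ) (k : ℕ) (b c d : ℂ) : ℂ :=
  awMean p k b c d *
    (qPochInf (p ^ k * b) p * qPochInf (p ^ k * c) p * qPochInf (p ^ k * d) p *
      qPochInf (b * c) p * qPochInf (b * d) p * qPochInf (c * d) p) /
    qPochInf (p ^ k * b * c * d) p

theorem awRatio_swap₁₂ (p : ℂ) (k : ℕ) (b c d : ℂ) : awRatio p k b c d = awRatio p k c b d := by
  rw [awRatio, awRatio, awMean_swap₁₂, mul_comm b c, mul_right_comm (p ^ k) b c]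
  ring

theorem awRatio_swap₁₃ (p : ℂ) (k : ℕ) (b c d : ℂ) : awRatio p k b c d = awRatio p k d c b := by
  rw [awRatio, awRatio, awMean_swap₁₃, mul_comm b c, mul_comm b d, mul_comm c d,
    show p ^ k * b * c * d = p ^ k * d * c * b by ring]
  ring

theorem norm_pow_mul_lt_one {p b : ℂ} (hp : ‖p‖ < 1) (hb : ‖b‖ < 1) (k : ℕ) :
    ‖p ^ k * b‖ < 1 := by
  rw [mul_comm]; exact norm_mul_pow_lt_one hb hp k

theorem awRatio_succ {p b c d : ℂ} (hp0 : p ≠ 0) (hp : ‖p‖ < 1) (hb : ‖b‖ < 1) (hc : ‖c‖ < 1)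
    (hd : ‖d‖ < 1) (k : ℕ) : awRatio p (k + 1) b c d = awRatio p k b c d := by
  have h := awMean_succ hp0 hp hb hc hd k
  have he : ‖p ^ k * b * c * d‖ < 1 :=
    norm_mul_lt_one (norm_mul_lt_one (norm_pow_mul_lt_one hp hb k) hc) hd
  have e (x : ℂ) : qPochInf x p = (1 - x) * qPochInf (x * p) p := qPochInf_eq_one_sub_mul x hp
  have n1 : qPochInf (p ^ k * b * c * d) p ≠ 0 := qPochInf_ne_zero he hp
  have r (x : ℂ) : p ^ (k + 1) * x = p ^ k * x * p := by ring
  rw [awRatio, awRatio, r, r, r, show p ^ k * b * p * c * d = p ^ k * b * c * d * p by ring,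
    e (p ^ k * b), e (p ^ k * c), e (p ^ k * d), e (p ^ k * b * c * d)]
  rw [e] at n1
  have n3 := right_ne_zero_of_mul n1
  rw [div_eq_div_iff n3 n1]
  linear_combination (qPochInf (p ^ k * b * c * d * p) p * qPochInf (p ^ k * b * p) p * qPochInf (p ^ k * c * p) p *
    qPochInf (p ^ k * d * p) p * qPochInf (b * c) p * qPochInf (b * d) p * qPochInf (c * d) p) * h

theorem awRatio_mul_right {p b c d : ℂ} (hp0 : p ≠ 0) (hp : ‖p‖ < 1) (hb : ‖b‖ < 1)
    (hc : ‖c‖ < 1) (hd : ‖d‖ < 1) (k : ℕ) : awRatio p k (b * p) c d = awRatio p k b c d := by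
  have h := awMean_mul_right hp0 hp hb hc hd k
  have he : ‖p ^ k * b * c * d‖ < 1 :=
    norm_mul_lt_one (norm_mul_lt_one (norm_pow_mul_lt_one hp hb k) hc) hd
  have e (x : ℂ) : qPochInf x p = (1 - x) * qPochInf (x * p) p := qPochInf_eq_one_sub_mul x hp
  have n1 : qPochInf (p ^ k * b * c * d) p ≠ 0 := qPochInf_ne_zero he hp
  rw [awRatio, awRatio, show p ^ k * (b * p) * c * d = p ^ k * b * c * d * p by ring,
    show p ^ k * (b * p) = p ^ k * b * p by ring, mul_right_comm b p c, mul_right_comm b p d,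
    e (p ^ k * b), e (b * c), e (b * d), e (p ^ k * b * c * d)]
  rw [e] at n1
  have n3 := right_ne_zero_of_mul n1
  rw [div_eq_div_iff n3 n1]
  linear_combination (qPochInf (p ^ k * b * c * d * p) p * qPochInf (p ^ k * b * p) p * qPochInf (p ^ k * c) p *
    qPochInf (p ^ k * d) p * qPochInf (b * c * p) p * qPochInf (b * d * p) p *
    qPochInf (c * d) p) * h

theorem awRatio_scale {p b c d : ℂ} (hp0 : p ≠ 0) (hp : ‖p‖ < 1) (hb : ‖b‖ < 1)
    (hc : ‖c‖ < 1) (hd : ‖d‖ < 1) (k n : ℕ) :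
    awRatio p (k + n) (b * p ^ n) (c * p ^ n) (d * p ^ n) = awRatio p k b c d := by
  induction n with
  | zero => simp
  | succ n ih =>
    have hb' := norm_mul_pow_lt_one hb hp n
    have hc' := norm_mul_pow_lt_one hc hp n
    have hd' := norm_mul_pow_lt_one hd hp n
    have hb1 := norm_mul_lt_one hb' hp
    have hc1 := norm_mul_lt_one hc' hp
    have hd1 := norm_mul_lt_one hd' hp
    rw [← ih, pow_succ, ← mul_assoc, ← mul_assoc, ← mul_assoc, ← add_assoc,
      awRatio_succ hp0 hp hb1 hc1 hd1, awRatio_mul_right hp0 hp hb' hc1 hd1,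
      awRatio_swap₁₂, awRatio_mul_right hp0 hp hc' hb' hd1, awRatio_swap₁₂,
      awRatio_swap₁₃, awRatio_mul_right hp0 hp hd' hc' hb', awRatio_swap₁₃]

/-- For `k ≥ 1` no regularization is needed: the weight has its usual form. -/
theorem pairPoch_mul_awWeight {p b c d z : ℂ} (hp : ‖p‖ < 1) (k : ℕ) (hz : ‖z‖ = 1) :
    pairPoch p 1 z (k + 1) * awWeight p b c d z =
      (1 - z ^ 2) * (1 - z⁻¹ ^ 2) * core p (p ^ (k + 1)) b c d z := by
  have h1 : (1 - z) * (1 - z⁻¹) * pairInf p p z =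
      pairPoch p 1 z (k + 1) * pairInf p (p ^ (k + 1)) z := by
    have e1 := qPochInf_eq_qPoch_mul z hp (k + 1)
    have e2 := qPochInf_eq_qPoch_mul z⁻¹ hp (k + 1)
    have e3 := pairInf_eq_mul hp 1 z
    simp only [one_mul] at e3
    rw [← e3, pairPoch, pairInf, pairInf, one_mul, one_mul, e1, e2, mul_comm z, mul_comm z⁻¹]
    ring
  have n1 := pairInf_ne_zero hp hp hz
  have n2 : pairInf p (p ^ (k + 1)) z ≠ 0 :=
    pairInf_ne_zero hp (norm_pow_lt_one hp k.succ_ne_zero) hz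
  have h2 : pairPoch p 1 z (k + 1) / pairInf p p z =
      (1 - z) * (1 - z⁻¹) / pairInf p (p ^ (k + 1)) z := by
    rw [div_eq_div_iff n1 n2, h1]
  simp only [awWeight, core]
  calc _ = (1 + z) * (1 + z⁻¹) * (qPochInf (p * z ^ 2) p * qPochInf (p * z⁻¹ ^ 2) p /
        (pairInf p b z * pairInf p c z * pairInf p d z)) *
        (pairPoch p 1 z (k + 1) / pairInf p p z) := by ring
    _ = _ := by rw [h2]; ring

/-- All the ratios agree with their common limit as the parameters tend to `0`. -/
theorem awRatio_eq_limit {p b c d : ℂ} (hp0 : p ≠ 0) (hp : ‖p‖ < 1) (hb : ‖b‖ < 1)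
    (hc : ‖c‖ < 1) (hd : ‖d‖ < 1) (k : ℕ) :
    awRatio p k b c d =
      circleAverage (fun z => (1 - z ^ 2) * (1 - z⁻¹ ^ 2) * core p 0 0 0 0 z) 0 1 := by
  rw [← awRatio_succ hp0 hp hb hc hd]
  have hk : ‖p ^ (k + 1)‖ < 1 := norm_pow_lt_one hp k.succ_ne_zero
  set a := p ^ (k + 1) with ha
  -- `H u` is the ratio with all four parameters scaled by `u`
  let H : ℂ → ℂ := fun u =>
    circleAverage (fun z => (1 - z ^ 2) * (1 - z⁻¹ ^ 2) *
      core p (a * u) (b * u) (c * u) (d * u) z) 0 1 *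
    (qPochInf (a * u * (b * u)) p * qPochInf (a * u * (c * u)) p * qPochInf (a * u * (d * u)) p *
      qPochInf (b * u * (c * u)) p * qPochInf (b * u * (d * u)) p *
      qPochInf (c * u * (d * u)) p) /
    qPochInf (a * u * (b * u) * (c * u) * (d * u)) p
  have hu {t u : ℂ} (ht : ‖t‖ < 1) (hu : u ∈ closedBall (0 : ℂ) 1) : ‖t * u‖ < 1 := by
    rw [norm_mul]
    exact (mul_le_of_le_one_right (norm_nonneg t) (by simpa using hu)).trans_lt ht
  have hcont : ContinuousOn H (closedBall 0 1) := by
    have hcq := continuous_qPochInf hp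
    refine ContinuousOn.div (ContinuousOn.mul ?_ ?_) ?_ ?_
    · apply continuousOn_circleAverage (F := fun u z => (1 - z ^ 2) * (1 - z⁻¹ ^ 2) *
        core p (a * u) (b * u) (c * u) (d * u) z)
      have h2 : ContinuousOn (fun x : ℂ × ℂ => x.2⁻¹) (closedBall 0 1 ×ˢ sphere 0 1) :=
        continuousOn_snd.inv₀ fun x hx => ne_of_mem_sphere hx.2 one_ne_zero
      refine ContinuousOn.mul (by fun_prop) (continuousOn_core hp (by fun_prop) (by fun_prop)
        (by fun_prop) (by fun_prop) continuousOn_snd (fun x hx => hu hk hx.1)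
        (fun x hx => hu hb hx.1) (fun x hx => hu hc hx.1) (fun x hx => hu hd hx.1)
        (fun x hx => by simpa using hx.2))
    · have (f : ℂ → ℂ) (hf : Continuous f) : Continuous fun u => qPochInf (f u) p := hcq.comp hf
      refine Continuous.continuousOn ?_
      exact (((((this _ (by fun_prop)).mul (this _ (by fun_prop))).mul (this _ (by fun_prop))).mul
        (this _ (by fun_prop))).mul (this _ (by fun_prop))).mul (this _ (by fun_prop))
    · exact (hcq.comp (by fun_prop : Continuous fun u : ℂ =>
        a * u * (b * u) * (c * u) * (d * u))).continuousOn
    · intro u h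
      exact qPochInf_ne_zero (norm_mul_lt_one (norm_mul_lt_one (norm_mul_lt_one (hu hk h)
        (hu hb h)) (hu hc h)) (hu hd h)) hp
  have hlim : Tendsto (fun n : ℕ => H (p ^ n)) atTop (𝓝 (H 0)) := by
    refine ((hcont 0 (by simp)).tendsto).comp (tendsto_nhdsWithin_iff.2
      ⟨tendsto_pow_atTop_nhds_zero_of_norm_lt_one hp, .of_forall fun n => ?_⟩)
    simpa using pow_le_one₀ (norm_nonneg p) hp.le
  have hH (n : ℕ) : H (p ^ n) = awRatio p (k + 1) b c d := by
    rw [← awRatio_scale hp0 hp hb hc hd (k + 1) n, awRatio, awMean]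
    have e : p ^ (k + 1 + n) = a * p ^ n := by rw [ha, ← pow_add]
    rw [circleAverage_congr_sphere (f₁ := fun z => pairPoch p 1 z (k + 1 + n) * _)
      (f₂ := fun z => (1 - z ^ 2) * (1 - z⁻¹ ^ 2) *
        core p (a * p ^ n) (b * p ^ n) (c * p ^ n) (d * p ^ n) z), e]
    intro z hz
    have hz1 : ‖z‖ = 1 := by simpa using hz
    simp only [← e, add_right_comm k 1 n]
    exact pairPoch_mul_awWeight hp (k + n) hz1
  simp only [hH] at hlim
  rw [tendsto_nhds_unique tendsto_const_nhds hlim]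
  simp [H]

theorem circleAverage_one_sub_sq :
    circleAverage (fun z : ℂ => (1 - z ^ 2) * (1 - z⁻¹ ^ 2)) 0 1 = 2 := by
  have hi := continuousOn_inv_sphere
  have c1 : CircleIntegrable (fun z : ℂ => (1 - z ^ 2) * (1 - z⁻¹ ^ 2)) 0 1 :=
    ContinuousOn.circleIntegrable zero_le_one (by fun_prop)
  -- the rotation `z ↦ iz` exchanges the integrand with its difference from `4`
  have h := circleAverage_comp_mul (fun z : ℂ => (1 - z ^ 2) * (1 - z⁻¹ ^ 2)) Complex.I
  rw [Complex.norm_I] at h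
  have h2 : circleAverage (fun z : ℂ => (4 : ℂ) - (1 - z ^ 2) * (1 - z⁻¹ ^ 2)) 0 1 =
      circleAverage (fun z : ℂ => (1 - z ^ 2) * (1 - z⁻¹ ^ 2)) 0 1 := by
    rw [← h]
    refine circleAverage_congr_sphere fun z hz => ?_
    have hz0 : z ≠ 0 := ne_of_mem_sphere (by simpa using hz) one_ne_zero
    simp only [mul_inv, Complex.inv_I, mul_pow, neg_sq, Complex.I_sq]
    field_simp
    ring
  rw [circleAverage_fun_sub (circleIntegrable_const _ _ _) c1, circleAverage_const] at h2
  linear_combination (-1 / 2) * h2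

theorem norm_lt_one_of_sq_eq {p s : ℂ} (hp : ‖p‖ < 1) (hs : s ^ 2 = p) : ‖s‖ < 1 := by
  rw [← hs, norm_pow] at hp
  exact (pow_lt_one_iff_of_nonneg (norm_nonneg s) two_ne_zero).1 hp

/-- The constant is found at the parameters `p, -p, s, -s` with `s² = p`, where the weight reduces
to `(1 - z²)(1 - z⁻²)`. -/
theorem awRatio_special {p s : ℂ} (hp : ‖p‖ < 1) (hs : s ^ 2 = p) :
    awRatio p 1 (-p) s (-s) = 2 / qPochInf p p := by
  have hs1 : ‖s‖ < 1 := norm_lt_one_of_sq_eq hp hs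
  have hhalf (y : ℂ) : qPochInf (p * y) p * qPochInf (-(p * y)) p *
      (qPochInf (s * y) p * qPochInf (-(s * y)) p) = qPochInf (p * y ^ 2) p := by
    rw [qPochInf_mul_qPochInf_neg _ hp, qPochInf_mul_qPochInf_neg _ hp,
      qPochInf_dissect_two (p * y ^ 2) hp, mul_pow s, hs, mul_comm]
    ring_nf
  have hmean : awMean p 1 (-p) s (-s) = 2 := by
    rw [← circleAverage_one_sub_sq, awMean]
    refine circleAverage_congr_sphere fun z hz => ?_
    have hz1 : ‖z‖ = 1 := by simpa using hz
    have h := pairPoch_mul_awWeight (p := p) (b := -p) (c := s) (d := -s) hp 0 hz1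
    simp only [zero_add] at h
    have hn : pairInf p p z * pairInf p (-p) z * pairInf p s z * pairInf p (-s) z ≠ 0 :=
      mul_ne_zero (mul_ne_zero (mul_ne_zero (pairInf_ne_zero hp hp hz1)
        (pairInf_ne_zero hp (by simpa using hp) hz1)) (pairInf_ne_zero hp hs1 hz1))
        (pairInf_ne_zero hp (by simpa using hs1) hz1)
    simp only [h, core, pow_one]
    rw [← hhalf z, ← hhalf z⁻¹]
    refine mul_right_eq_self₀.2 (Or.inl ?_)
    rw [div_eq_one_iff_eq hn]
    simp only [pairInf, neg_mul]
    ring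
  have e (x : ℂ) : qPochInf x p = (1 - x) * qPochInf (x * p) p := qPochInf_eq_one_sub_mul x hp
  have hp2 : ‖p ^ 2‖ < 1 := norm_pow_lt_one hp two_ne_zero
  have hp3 : ‖p ^ 3‖ < 1 := norm_pow_lt_one hp three_ne_zero
  have hE := euler_odd_distinct hp
  have e2 : qPochInf p (p ^ 2) = (1 - p) * qPochInf (p ^ 3) (p ^ 2) := by
    rw [qPochInf_eq_one_sub_mul _ hp2]; ring_nf
  have e3 : qPochInf (-p) p = (1 + p) * qPochInf (-p ^ 2) p := by rw [e]; ring_nf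
  have e4 : qPochInf p p = (1 - p) * (1 - p ^ 2) * qPochInf (p ^ 3) p := by
    rw [e, e (p * p)]; ring_nf
  have e5 : qPochInf (p * s) p * qPochInf (-(p * s)) p = qPochInf (p ^ 3) (p ^ 2) := by
    rw [qPochInf_mul_qPochInf_neg _ hp, mul_pow, hs]; ring_nf
  have n1 : qPochInf (p ^ 3) p ≠ 0 := qPochInf_ne_zero hp3 hp
  have n2 : qPochInf p p ≠ 0 := qPochInf_ne_zero hp hp
  rw [awRatio, hmean, pow_one, show p * -p * s * -s = p ^ 3 by rw [← hs]; ring,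
    show p * -p = -p ^ 2 by ring, show p * -s = -(p * s) by ring, show -p * s = -(p * s) by ring,
    show -p * -s = p * s by ring, show s * -s = -p by rw [← hs]; ring, div_eq_div_iff n1 n2]
  rw [e2] at hE
  rw [e3] at hE ⊢
  rw [e4]
  generalize qPochInf (-p ^ 2) p = E at *
  generalize qPochInf (p ^ 3) (p ^ 2) = F at *
  linear_combination (2 * (1 - p ^ 2) ^ 2 * qPochInf (p ^ 3) p * E ^ 2 *
    (qPochInf (p * s) p * qPochInf (-(p * s)) p + F)) * e5 +
    2 * qPochInf (p ^ 3) p * ((1 - p ^ 2) * E * F + 1) * hE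

/-- The Askey–Wilson integral with first parameter `p ^ k`. -/
theorem awMean_eq {p b c d : ℂ} (hp0 : p ≠ 0) (hp : ‖p‖ < 1) (hb : ‖b‖ < 1)
    (hc : ‖c‖ < 1) (hd : ‖d‖ < 1) (k : ℕ) :
    awMean p k b c d * (qPochInf p p *
      (qPochInf (p ^ k * b) p * qPochInf (p ^ k * c) p * qPochInf (p ^ k * d) p *
      qPochInf (b * c) p * qPochInf (b * d) p * qPochInf (c * d) p)) =
    2 * qPochInf (p ^ k * b * c * d) p := by
  obtain ⟨s, hs⟩ := IsAlgClosed.exists_pow_nat_eq p two_pos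
  have hs1 : ‖s‖ < 1 := norm_lt_one_of_sq_eq hp hs
  have h1 := awRatio_eq_limit hp0 hp hb hc hd k
  rw [← awRatio_eq_limit (b := -p) (c := s) (d := -s) hp0 hp (by simpa using hp) hs1
    (by simpa using hs1) 1, awRatio_special hp hs, awRatio, div_eq_div_iff
    (qPochInf_ne_zero (norm_mul_lt_one (norm_mul_lt_one (norm_pow_mul_lt_one hp hb k) hc) hd) hp)
    (qPochInf_ne_zero hp hp)] at h1
  rw [← h1]
  ring

/-! ### The coefficients `(p⁻ⁿ;p)_k p^k / (p;p)_k` -/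

/-- The coefficient `(p⁻ⁿ;p)_k p^k / (p;p)_k` of a terminating basic hypergeometric sum. -/
noncomputable def termCoeff (p : ℂ) (n k : ℕ) : ℂ :=
  qPoch (p ^ (-(n : ℤ))) p k / qPoch p p k * p ^ k

/-- The sum `∑_{k ≤ n} (p⁻ⁿ;p)_k p^k / (p;p)_k G(k)`, an iterated `p`-difference of `G`. -/
noncomputable def termSum (p : ℂ) (n : ℕ) (G : ℕ → ℂ) : ℂ :=
  ∑ k ∈ Finset.range (n + 1), termCoeff p n k * G k

theorem termCoeff_succ_succ {p : ℂ} (hp0 : p ≠ 0) (hp : ‖p‖ < 1) (n k : ℕ) :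
    termCoeff p (n + 1) (k + 1) = termCoeff p n (k + 1) - (p ^ n)⁻¹ * termCoeff p n k := by
  have h1 : qPoch p p k ≠ 0 := qPoch_ne_zero hp hp k
  have h2 : qPoch p p (k + 1) ≠ 0 := qPoch_ne_zero hp hp (k + 1)
  have e1 : p ^ (-((n + 1 : ℕ) : ℤ)) * p = p ^ (-(n : ℤ)) := by
    rw [← zpow_add_one₀ hp0]
    congr 1
    push_cast
    ring
  have e2 : p ^ (-(n : ℤ)) = (p ^ n)⁻¹ := by simp
  have e3 : p ^ (-((n + 1 : ℕ) : ℤ)) = (p ^ (n + 1))⁻¹ := by rw [zpow_neg, zpow_natCast]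
  rw [termCoeff, termCoeff, termCoeff, qPoch_succ' (p ^ (-((n + 1 : ℕ) : ℤ))), e1,
    qPoch_succ (p ^ (-(n : ℤ)))]
  rw [qPoch_succ] at h2 ⊢
  have h3 := right_ne_zero_of_mul h2
  rw [e2, e3, pow_succ p n, pow_succ p k]
  rw [← pow_succ'] at h3 ⊢
  rw [pow_succ] at h3 ⊢
  have hn : p ^ n ≠ 0 := pow_ne_zero n hp0
  generalize qPoch (p ^ n)⁻¹ p k = X
  generalize qPoch p p k = Y at *
  generalize p ^ n = N at *
  generalize p ^ k = K at *
  have h4 : Y * (1 - K * p) ≠ 0 := mul_ne_zero h1 h3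
  rw [div_mul_eq_mul_div, div_mul_eq_mul_div, div_mul_eq_mul_div, ← mul_div_assoc,
    eq_sub_iff_add_eq, div_add_div _ _ h4 h1, div_eq_div_iff (mul_ne_zero h4 h1) h4]
  field_simp
  ring

@[simp] theorem termCoeff_zero_right (p : ℂ) (n : ℕ) : termCoeff p n 0 = 1 := by
  simp [termCoeff]

theorem termCoeff_eq_zero {p : ℂ} (hp0 : p ≠ 0) {n k : ℕ} (h : n < k) : termCoeff p n k = 0 := by
  rw [termCoeff, qPoch_neg_pow_eq_zero hp0 h, zero_div, zero_mul]

theorem termSum_succ {p : ℂ} (hp0 : p ≠ 0) (hp : ‖p‖ < 1) (n : ℕ) (G : ℕ → ℂ) :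
    termSum p (n + 1) G = termSum p n G - (p ^ n)⁻¹ * termSum p n (fun k => G (k + 1)) := by
  have h : termSum p n G = ∑ k ∈ Finset.range (n + 2), termCoeff p n k * G k := by
    rw [Finset.sum_range_succ, termCoeff_eq_zero hp0 (Nat.lt_succ_self n), zero_mul, add_zero,
      termSum]
  rw [h, termSum, Finset.sum_range_succ', Finset.sum_range_succ' _ (n + 1), termSum,
    Finset.mul_sum]
  simp only [termCoeff_succ_succ hp0 hp, sub_mul, Finset.sum_sub_distrib, termCoeff_zero_right,
    mul_assoc]
  ring

theorem termSum_sub (p : ℂ) (n : ℕ) (G H : ℕ → ℂ) :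
    termSum p n (fun k => G k - H k) = termSum p n G - termSum p n H := by
  simp [termSum, mul_sub]

theorem termSum_add (p : ℂ) (n : ℕ) (G H : ℕ → ℂ) :
    termSum p n (fun k => G k + H k) = termSum p n G + termSum p n H := by
  simp [termSum, mul_add, Finset.sum_add_distrib]

theorem termSum_const_mul (p : ℂ) (n : ℕ) (a : ℂ) (G : ℕ → ℂ) :
    termSum p n (fun k => a * G k) = a * termSum p n G := by
  simp only [termSum, Finset.mul_sum]
  exact Finset.sum_congr rfl fun _ _ => by ring

/-- The `n`-th sum annihilates the values at `p ^ k` of polynomials of degree less than `n`: each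
`p`-difference `g(x) - p⁻ⁿ g(px)` cancels a leading term. -/
theorem termSum_polynomial {p : ℂ} (hp0 : p ≠ 0) (hp : ‖p‖ < 1) (n : ℕ) (g : ℂ[X])
    (hg : g.degree < n) : termSum p n (fun k => g.eval (p ^ k)) = 0 := by
  induction n generalizing g with
  | zero =>
    have : g = 0 := by simpa using hg
    simp [this, termSum]
  | succ n ih =>
    have h := ih (g - Polynomial.C (p ^ n)⁻¹ * g.comp (Polynomial.C p * X)) (by
      rw [degree_lt_iff_coeff_zero] at hg ⊢
      intro m hm
      rw [coeff_sub, coeff_C_mul, comp_C_mul_X_coeff]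
      rcases hm.eq_or_lt with rfl | hm
      · have : p ^ n ≠ 0 := pow_ne_zero n hp0
        field_simp
        ring
      · simp [hg m hm])
    rw [termSum_succ hp0 hp, ← termSum_const_mul, ← termSum_sub, ← h]
    congr 1 with k
    simp [pow_succ']

theorem termSum_one_div {p : ℂ} (hp0 : p ≠ 0) (hp : ‖p‖ < 1) (n : ℕ) {f : ℂ} (hf : ‖f‖ < 1) :
    termSum p n (fun k => 1 / (1 - f * p ^ k)) = qPoch p p n * f ^ n / qPoch f p (n + 1) := by
  induction n generalizing f with
  | zero => simp [termSum]
  | succ n ih =>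
    have hfp := norm_mul_lt_one hf hp
    have h1 : termSum p n (fun k => 1 / (1 - f * p ^ (k + 1))) =
        qPoch p p n * (f * p) ^ n / qPoch (f * p) p (n + 1) := by
      rw [← ih hfp]
      congr 1 with k
      rw [pow_succ']
      ring
    have n1 : qPoch f p (n + 1) ≠ 0 := qPoch_ne_zero hf hp _
    have n2 : qPoch (f * p) p (n + 1) ≠ 0 := qPoch_ne_zero hfp hp _
    have n3 : qPoch f p (n + 2) ≠ 0 := qPoch_ne_zero hf hp _
    have hn : p ^ n ≠ 0 := pow_ne_zero n hp0
    have e1 : qPoch f p (n + 2) = qPoch f p (n + 1) * (1 - f * p ^ (n + 1)) := qPoch_succ ..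
    have e2 : qPoch f p (n + 2) = (1 - f) * qPoch (f * p) p (n + 1) := qPoch_succ' ..
    have d1 : 1 / qPoch f p (n + 1) = (1 - f * p ^ (n + 1)) / qPoch f p (n + 2) := by
      rw [div_eq_div_iff n1 n3, e1]; ring
    have d2 : 1 / qPoch (f * p) p (n + 1) = (1 - f) / qPoch f p (n + 2) := by
      rw [div_eq_div_iff n2 n3, e2]; ring
    rw [termSum_succ hp0 hp, ih hf, h1, qPoch_succ p p n, mul_pow]
    have c1 : (p ^ n)⁻¹ * (qPoch p p n * (f ^ n * p ^ n) / qPoch (f * p) p (n + 1)) =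
        qPoch p p n * f ^ n * (1 / qPoch (f * p) p (n + 1)) := by
      field_simp
    rw [c1, d2, div_eq_mul_one_div (qPoch p p n * f ^ n), d1]
    ring

/-- The product `∏_{i<n} (1 - u pⁱ X)`, whose value at `p ^ k` is `(u p^k; p)_n`. -/
noncomputable def qPochPoly (u p : ℂ) (n : ℕ) : ℂ[X] :=
  ∏ i ∈ Finset.range n, (1 - Polynomial.C (u * p ^ i) * X)

theorem eval_qPochPoly (u p x : ℂ) (n : ℕ) : (qPochPoly u p n).eval x = qPoch (u * x) p n := by
  simp only [qPochPoly, eval_prod, qPoch]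
  refine Finset.prod_congr rfl fun i _ => ?_
  simp
  ring

theorem degree_qPochPoly_le (u p : ℂ) (n : ℕ) : (qPochPoly u p n).degree ≤ n := by
  refine (degree_prod_le _ _).trans ((Finset.sum_le_card_nsmul _ _ 1 fun i _ => ?_).trans ?_)
  · refine (degree_sub_le _ _).trans (max_le (degree_one_le.trans zero_le_one) ?_)
    exact degree_C_mul_X_le _
  · simp

/-- The balanced terminating sum with a simple pole, by splitting off the value at the pole. -/
theorem termSum_qPoch_div {p : ℂ} (hp0 : p ≠ 0) (hp : ‖p‖ < 1) (n : ℕ) {f : ℂ} (hf0 : f ≠ 0)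
    (hf : ‖f‖ < 1) (u : ℂ) :
    termSum p (n + 1) (fun k => qPoch (u * p ^ k) p (n + 1) / (1 - f * p ^ k)) =
      (∏ i ∈ Finset.range (n + 1), (f - u * p ^ i)) * qPoch p p (n + 1) /
        qPoch f p (n + 2) := by
  obtain ⟨r, hr⟩ := X_sub_C_dvd_sub_C_eval (a := f⁻¹) (p := qPochPoly u p (n + 1))
  set g := qPochPoly u p (n + 1) with hg
  have hdeg : r.degree < ((n + 1 : ℕ) : WithBot ℕ) := by
    by_cases hr0 : r = 0
    · rw [hr0, Polynomial.degree_zero]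
      exact WithBot.bot_lt_coe _
    have h1 : ((X - Polynomial.C f⁻¹) * r).degree ≤ ((n + 1 : ℕ) : WithBot ℕ) := by
      rw [← hr]
      exact (degree_sub_le _ _).trans (max_le (degree_qPochPoly_le _ _ _)
        (degree_C_le.trans (by exact_mod_cast Nat.zero_le _)))
    rw [degree_mul, degree_X_sub_C, degree_eq_natDegree hr0] at h1
    rw [degree_eq_natDegree hr0]
    norm_cast at h1 ⊢
    omega
  have hval (k : ℕ) : qPoch (u * p ^ k) p (n + 1) / (1 - f * p ^ k) =
      g.eval f⁻¹ * (1 / (1 - f * p ^ k)) + (-f⁻¹) * r.eval (p ^ k) := by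
    have hne : 1 - f * p ^ k ≠ 0 := one_sub_ne_zero_of_norm_lt_one (norm_mul_pow_lt_one hf hp k)
    have h1 := congrArg (Polynomial.eval (p ^ k)) hr
    rw [eval_sub, eval_mul, eval_sub, eval_C, eval_X, eval_C, hg, eval_qPochPoly, ← hg] at h1
    rw [eq_add_of_sub_eq h1]
    generalize hD : 1 - f * p ^ k = D at *
    have hp' : p ^ k = f⁻¹ * (1 - D) := by rw [← hD]; field_simp; ring
    rw [hp']
    field_simp
    ring
  simp only [hval]
  rw [termSum_add, termSum_const_mul, termSum_const_mul, termSum_polynomial hp0 hp _ r hdeg,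
    termSum_one_div hp0 hp _ hf, hg, eval_qPochPoly, mul_zero, add_zero]
  have : qPoch (u * f⁻¹) p (n + 1) * f ^ (n + 1) = ∏ i ∈ Finset.range (n + 1), (f - u * p ^ i) := by
    rw [qPoch, ← Finset.card_range (n + 1), ← Finset.prod_const, Finset.card_range,
      ← Finset.prod_mul_distrib]
    refine Finset.prod_congr rfl fun i _ => ?_
    field_simp
  rw [← this]
  ring

/-- The last coefficient, in the combination with the residue product in which it is needed. -/
theorem termCoeff_self_mul {p : ℂ} (hp0 : p ≠ 0) (hp : ‖p‖ < 1) (n : ℕ) (v : ℂ) :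
    termCoeff p (n + 1) (n + 1) * ∏ i ∈ Finset.range (n + 1), (v * p ^ n - p ^ i) =
      qPoch v p (n + 1) := by
  have h1 : ∏ i ∈ Finset.range (n + 1), (v * p ^ n - p ^ i) =
      (∏ i ∈ Finset.range (n + 1), -p ^ i) * qPoch v p (n + 1) := by
    rw [qPoch, ← Finset.prod_range_reflect (fun j => 1 - v * p ^ j), ← Finset.prod_mul_distrib]
    refine Finset.prod_congr rfl fun i hi => ?_
    have hi' : i ≤ n := Nat.lt_succ_iff.1 (Finset.mem_range.1 hi)
    rw [show n + 1 - 1 - i = n - i by omega]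
    have : p ^ i * p ^ (n - i) = p ^ n := by rw [← pow_add]; congr 1; omega
    linear_combination (-v) * this
  have h2 : qPoch (p ^ (-((n + 1 : ℕ) : ℤ))) p (n + 1) * p ^ (n + 1) *
      ∏ i ∈ Finset.range (n + 1), -p ^ i = qPoch p p (n + 1) := by
    rw [← Finset.prod_range_reflect (fun i => -p ^ i), qPoch, qPoch,
      ← Finset.prod_range_reflect (fun j => 1 - p * p ^ j)]
    have hpow : p ^ (n + 1) = ∏ _i ∈ Finset.range (n + 1), p := by simp
    rw [hpow, ← Finset.prod_mul_distrib, ← Finset.prod_mul_distrib]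
    refine Finset.prod_congr rfl fun i hi => ?_
    have hi' : i ≤ n := Nat.lt_succ_iff.1 (Finset.mem_range.1 hi)
    obtain ⟨j, rfl⟩ := Nat.exists_eq_add_of_le hi'
    rw [show i + j + 1 - 1 - i = j by omega, zpow_neg, zpow_natCast]
    field_simp
    ring
  have n1 : qPoch p p (n + 1) ≠ 0 := qPoch_ne_zero hp hp _
  rw [h1, termCoeff, ← mul_assoc]
  refine mul_left_eq_self₀.2 (Or.inl ?_)
  rw [div_mul_eq_mul_div, div_mul_eq_mul_div, h2, div_self n1]

/-! ### Askey–Wilson polynomials for a functional with product moments -/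

/-- The polynomial in `x = (z + z⁻¹)/2` equal to `(az, a/z; p)_k`. -/
noncomputable def pairPoly (a p : ℂ) (k : ℕ) : ℂ[X] :=
  ∏ j ∈ Finset.range k,
    (1 - Polynomial.C (2 * a * p ^ j) * X + Polynomial.C (a ^ 2 * p ^ (2 * j)))

theorem eval_pairPoly (a p : ℂ) (k : ℕ) {z : ℂ} (hz : z ≠ 0) :
    (pairPoly a p k).eval ((z + z⁻¹) / 2) = pairPoch p a z k := by
  simp only [pairPoly, eval_prod, pairPoch, qPoch, ← Finset.prod_mul_distrib]
  refine Finset.prod_congr rfl fun j _ => ?_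
  have h : z * z⁻¹ = 1 := mul_inv_cancel₀ hz
  simp only [eval_add, eval_sub, eval_one, eval_mul, eval_C, eval_X]
  linear_combination (-a ^ 2 * p ^ (2 * j)) * h

theorem natDegree_pairPoly_factor_le (x y : ℂ) :
    (1 - Polynomial.C x * X + Polynomial.C y).natDegree ≤ 1 := by
  compute_degree

theorem degree_pairPoly_le (a p : ℂ) (k : ℕ) : (pairPoly a p k).degree ≤ k := by
  refine (degree_prod_le _ _).trans ((Finset.sum_le_card_nsmul _ _ 1 fun i _ => ?_).trans ?_)
  · exact natDegree_le_iff_degree_le.1 (natDegree_pairPoly_factor_le _ _)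
  · simp

theorem coeff_pairPoly (a p : ℂ) (k : ℕ) :
    (pairPoly a p k).coeff k = a ^ k * ∏ j ∈ Finset.range k, (-2 * p ^ j) := by
  have h := coeff_prod_of_natDegree_le (Finset.range k)
    (fun j => 1 - Polynomial.C (2 * a * p ^ j) * X + Polynomial.C (a ^ 2 * p ^ (2 * j))) 1
    fun j _ => natDegree_pairPoly_factor_le _ _
  have hpow : a ^ k = ∏ _i ∈ Finset.range k, a := by simp
  rw [Finset.card_range, mul_one] at h
  rw [pairPoly, h, hpow, ← Finset.prod_mul_distrib]
  refine Finset.prod_congr rfl fun j _ => ?_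
  rw [coeff_add, coeff_sub, coeff_one, coeff_C_mul, coeff_X_one, coeff_C]
  simp
  ring

/-- A functional `f ↦ Λ (P f)` that vanishes on a sequence of polynomials of degrees
`0, …, n - 1` vanishes in all degrees below `n`. -/
theorem functional_eq_zero_of_degree_lt {Λ : ℂ[X] →ₗ[ℂ] ℂ} {P : ℂ[X]} {T : ℕ → ℂ[X]} {n : ℕ}
    (hT : ∀ j, (T j).degree ≤ j) (hT0 : ∀ j, (T j).coeff j ≠ 0)
    (h : ∀ j < n, Λ (P * T j) = 0) {f : ℂ[X]} (hf : f.degree < n) : Λ (P * f) = 0 := by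
  induction n generalizing f with
  | zero =>
    have : f = 0 := by simpa using hf
    simp [this]
  | succ n ih =>
    have h1 : (f - Polynomial.C (f.coeff n / (T n).coeff n) * T n).degree < n := by
      rw [degree_lt_iff_coeff_zero] at hf ⊢
      intro m hm
      rw [coeff_sub, coeff_C_mul]
      rcases hm.eq_or_lt with rfl | hm
      · rw [div_mul_cancel₀ _ (hT0 n), sub_self]
      · rw [hf m hm, coeff_eq_zero_of_degree_lt (n := m) ((hT n).trans_lt (by exact_mod_cast hm)),
          mul_zero, sub_zero]
    have h2 := ih (fun j hj => h j (hj.trans n.lt_succ_self)) h1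
    have e : P * f = P * (f - Polynomial.C (f.coeff n / (T n).coeff n) * T n) +
        (f.coeff n / (T n).coeff n) • (P * T n) := by
      rw [smul_eq_C_mul]; ring
    rw [e, map_add, h2, map_smul, h n n.lt_succ_self, smul_zero, add_zero]

/-- If `Λ (P ·)` vanishes on `T 0, …, T (n - 1)`, then on polynomials of degree at most `n` it
depends only on the leading coefficient. -/
theorem functional_mul_coeff {Λ : ℂ[X] →ₗ[ℂ] ℂ} {P : ℂ[X]} {T : ℕ → ℂ[X]} {n : ℕ}
    (hT : ∀ j, (T j).degree ≤ j) (hT0 : ∀ j, (T j).coeff j ≠ 0)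
    (h : ∀ j < n, Λ (P * T j) = 0) {f : ℂ[X]} (hf : f.degree ≤ n) :
    Λ (P * f) * (T n).coeff n = f.coeff n * Λ (P * T n) := by
  have h1 : (Polynomial.C ((T n).coeff n) * f - Polynomial.C (f.coeff n) * T n).degree < n := by
    rw [degree_lt_iff_coeff_zero]
    intro m hm
    rw [coeff_sub, coeff_C_mul, coeff_C_mul]
    rcases hm.eq_or_lt with rfl | hm
    · ring
    · have hm' : (n : WithBot ℕ) < m := by exact_mod_cast hm
      rw [coeff_eq_zero_of_degree_lt (hf.trans_lt hm'),
        coeff_eq_zero_of_degree_lt ((hT n).trans_lt hm')]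
      simp
  have h2 := functional_eq_zero_of_degree_lt hT hT0 h h1
  have e : P * (Polynomial.C ((T n).coeff n) * f - Polynomial.C (f.coeff n) * T n) =
      (T n).coeff n • (P * f) - f.coeff n • (P * T n) := by
    rw [smul_eq_C_mul, smul_eq_C_mul]; ring
  rw [e, map_sub, map_smul, map_smul, smul_eq_mul, smul_eq_mul] at h2
  linear_combination h2

/-- The functional `Λ` takes on the products `(az, a/z; p)_k (bz, b/z; p)_j` the values it has for
the Askey–Wilson weight. -/
def HasProductMoments (Λ : ℂ[X] →ₗ[ℂ] ℂ) (p a b c d : ℂ) : Prop :=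
  ∀ k j, Λ (pairPoly a p k * pairPoly b p j) * qPoch (a * b * c * d) p (k + j) =
    Λ 1 * (qPoch (a * b) p (k + j) * qPoch (a * c) p k * qPoch (a * d) p k *
      (qPoch (b * c) p j * qPoch (b * d) p j))

theorem askeyWilson_eq (n : ℕ) (a b c d p : ℂ) :
    askeyWilson (n + 1) a b c d p =
      Polynomial.C (qPoch (a * b) p (n + 1) * qPoch (a * c) p (n + 1) * qPoch (a * d) p (n + 1) /
        a ^ (n + 1)) *
      ∑ k ∈ Finset.range (n + 2), Polynomial.C (termCoeff p (n + 1) k *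
        (qPoch (a * b * c * d * p ^ n) p k /
          (qPoch (a * b) p k * qPoch (a * c) p k * qPoch (a * d) p k))) * pairPoly a p k := by
  have e : p ^ (((n + 1 : ℕ) : ℤ) - 1) = p ^ n := by simp
  rw [askeyWilson, e]
  congr 1
  refine Finset.sum_congr rfl fun k _ => ?_
  rw [termCoeff, pairPoly]
  congr 2
  simp only [div_eq_mul_inv, mul_inv]
  ring

theorem askeyWilson_zero (a b c d p : ℂ) : askeyWilson 0 a b c d p = 1 := by
  simp [askeyWilson]

theorem degree_const_mul_le (x : ℂ) (f : ℂ[X]) : (Polynomial.C x * f).degree ≤ f.degree := by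
  rw [← smul_eq_C_mul]
  exact degree_smul_le x f

theorem degree_askeyWilson_le (n : ℕ) (a b c d p : ℂ) : (askeyWilson n a b c d p).degree ≤ n := by
  rw [askeyWilson]
  refine (degree_const_mul_le _ _).trans ((degree_sum_le _ _).trans (Finset.sup_le fun k hk => ?_))
  refine (degree_const_mul_le _ _).trans ((degree_pairPoly_le a p k).trans ?_)
  exact_mod_cast Nat.lt_succ_iff.1 (Finset.mem_range.1 hk)

theorem coeff_askeyWilson_succ {p a b c d : ℂ} (hp : ‖p‖ < 1) (ha : a ≠ 0) (hab : ‖a * b‖ < 1)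
    (hac : ‖a * c‖ < 1) (had : ‖a * d‖ < 1) (n : ℕ) :
    (askeyWilson (n + 1) a b c d p).coeff (n + 1) =
      termCoeff p (n + 1) (n + 1) * qPoch (a * b * c * d * p ^ n) p (n + 1) *
        ∏ j ∈ Finset.range (n + 1), (-2 * p ^ j) := by
  have n1 : qPoch (a * b) p (n + 1) ≠ 0 := qPoch_ne_zero hab hp _
  have n2 : qPoch (a * c) p (n + 1) ≠ 0 := qPoch_ne_zero hac hp _
  have n3 : qPoch (a * d) p (n + 1) ≠ 0 := qPoch_ne_zero had hp _
  rw [askeyWilson_eq, coeff_C_mul, finsetSum_coeff, Finset.sum_range_succ,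
    Finset.sum_eq_zero fun k hk => ?_, zero_add, coeff_C_mul, coeff_pairPoly]
  · field_simp
  · rw [coeff_C_mul, coeff_eq_zero_of_degree_lt ((degree_pairPoly_le a p k).trans_lt ?_), mul_zero]
    exact_mod_cast Finset.mem_range.1 hk

section moments

variable {p a b c d : ℂ} {Λ : ℂ[X] →ₗ[ℂ] ℂ}

/-- Expansion of the Askey–Wilson polynomial in the family `(az, a/z; p)_k`, tested against
`(bz, b/z; p)_j`. -/
theorem functional_askeyWilson_mul (hp : ‖p‖ < 1) (hab : ‖a * b‖ < 1)
    (hac : ‖a * c‖ < 1) (had : ‖a * d‖ < 1) (he : ‖a * b * c * d‖ < 1)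
    (hΛ : HasProductMoments Λ p a b c d) (n j : ℕ) :
    Λ (askeyWilson (n + 1) a b c d p * pairPoly b p j) =
      qPoch (a * b) p (n + 1) * qPoch (a * c) p (n + 1) * qPoch (a * d) p (n + 1) / a ^ (n + 1) *
        (Λ 1 * (qPoch (b * c) p j * qPoch (b * d) p j)) *
        termSum p (n + 1) fun k => qPoch (a * b * p ^ k) p j *
          (qPoch (a * b * c * d * p ^ n) p k / qPoch (a * b * c * d) p (k + j)) := by
  rw [askeyWilson_eq, ← smul_eq_C_mul, smul_mul_assoc, map_smul, smul_eq_mul,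
    mul_assoc (_ / a ^ (n + 1))]
  congr 1
  rw [Finset.sum_mul, map_sum, termSum, Finset.mul_sum]
  refine Finset.sum_congr rfl fun k _ => ?_
  have n1 : qPoch (a * b) p k ≠ 0 := qPoch_ne_zero hab hp _
  have n2 : qPoch (a * c) p k ≠ 0 := qPoch_ne_zero hac hp _
  have n3 : qPoch (a * d) p k ≠ 0 := qPoch_ne_zero had hp _
  have n4 : qPoch (a * b * c * d) p (k + j) ≠ 0 := qPoch_ne_zero he hp _
  have h := hΛ k j
  rw [← eq_div_iff n4, qPoch_add (a * b)] at h
  rw [← smul_eq_C_mul, smul_mul_assoc, map_smul, smul_eq_mul, h]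
  generalize qPoch (a * b * p ^ k) p j = Y
  field_simp

theorem functional_askeyWilson_mul_eq_zero (hp0 : p ≠ 0) (hp : ‖p‖ < 1) (hab : ‖a * b‖ < 1)
    (hac : ‖a * c‖ < 1) (had : ‖a * d‖ < 1) (he : ‖a * b * c * d‖ < 1)
    (hΛ : HasProductMoments Λ p a b c d) {n j : ℕ} (hj : j < n) :
    Λ (askeyWilson n a b c d p * pairPoly b p j) = 0 := by
  obtain ⟨n, rfl⟩ : ∃ m, n = m + 1 := ⟨n - 1, by omega⟩
  obtain ⟨i, rfl⟩ := Nat.exists_eq_add_of_le (Nat.lt_succ_iff.1 hj)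
  rw [functional_askeyWilson_mul hp hab hac had he hΛ]
  set e := a * b * c * d
  -- the summand is a polynomial of degree `n` in `p ^ k`
  have h := termSum_polynomial hp0 hp (j + i + 1)
    (qPochPoly (a * b) p j * (qPochPoly (e * p ^ j) p i * Polynomial.C (qPoch e p (j + i))⁻¹)) (by
      refine lt_of_le_of_lt (b := ((j + i : ℕ) : WithBot ℕ)) ?_ (by exact_mod_cast Nat.lt_succ_self _)
      refine (degree_mul_le _ _).trans ?_
      rw [Nat.cast_add]
      refine add_le_add (degree_qPochPoly_le _ _ _) ((degree_mul_le _ _).trans ?_)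
      exact (add_le_add (degree_qPochPoly_le _ _ _) degree_C_le).trans (by simp))
  rw [mul_eq_zero]
  right
  rw [← h]
  congr 1 with k
  rw [eval_mul, eval_mul, eval_C, eval_qPochPoly, eval_qPochPoly]
  congr 1
  have n1 : qPoch e p (k + j) ≠ 0 := qPoch_ne_zero he hp _
  have n2 : qPoch e p (j + i) ≠ 0 := qPoch_ne_zero he hp _
  have e1 : qPoch e p (j + i) * qPoch (e * p ^ (j + i)) p k =
      qPoch e p (k + j) * qPoch (e * p ^ j * p ^ k) p i := by
    rw [← qPoch_add, mul_assoc e, ← pow_add, add_comm j k, ← qPoch_add]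
    congr 1
    ring
  rw [← div_eq_mul_inv, div_eq_div_iff n1 n2]
  linear_combination e1

/-- The degree-`n + 1` test. The left factor `termCoeff` is part of the leading coefficient of the
polynomial; including it cancels the powers of `p`. -/
theorem functional_askeyWilson_mul_self (hp0 : p ≠ 0) (hp : ‖p‖ < 1) (ha0 : a ≠ 0) (hb0 : b ≠ 0)
    (hc0 : c ≠ 0) (hd0 : d ≠ 0) (hab : ‖a * b‖ < 1)
    (hac : ‖a * c‖ < 1) (had : ‖a * d‖ < 1) (he : ‖a * b * c * d‖ < 1)
    (hΛ : HasProductMoments Λ p a b c d) (n : ℕ) :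
    termCoeff p (n + 1) (n + 1) * Λ (askeyWilson (n + 1) a b c d p * pairPoly b p (n + 1)) *
        (qPoch (a * b * c * d) p (2 * (n + 1))) =
      Λ 1 * b ^ (n + 1) * (qPoch p p (n + 1) *
        (qPoch (a * b) p (n + 1) * qPoch (a * c) p (n + 1) * qPoch (a * d) p (n + 1) *
          qPoch (b * c) p (n + 1) * qPoch (b * d) p (n + 1) * qPoch (c * d) p (n + 1))) := by
  rw [functional_askeyWilson_mul hp hab hac had he hΛ]
  have hfe : a * b * c * d * p ^ n = a * b * (c * d * p ^ n) := by ring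
  set e := a * b * c * d with hee
  have he0 : e ≠ 0 := by simp [hee, ha0, hb0, hc0, hd0]
  have hf0 : e * p ^ n ≠ 0 := mul_ne_zero he0 (pow_ne_zero n hp0)
  have hf : ‖e * p ^ n‖ < 1 := norm_mul_pow_lt_one he hp n
  have n1 : qPoch e p n ≠ 0 := qPoch_ne_zero he hp _
  have hsum : termSum p (n + 1) (fun k => qPoch (a * b * p ^ k) p (n + 1) *
      (qPoch (e * p ^ n) p k / qPoch e p (k + (n + 1)))) =
      (qPoch e p n)⁻¹ * ((∏ i ∈ Finset.range (n + 1), (e * p ^ n - a * b * p ^ i)) *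
        qPoch p p (n + 1) / qPoch (e * p ^ n) p (n + 2)) := by
    rw [← termSum_qPoch_div hp0 hp n hf0 hf, ← termSum_const_mul]
    congr 1 with k
    have n2 : qPoch (e * p ^ n) p k ≠ 0 := qPoch_ne_zero hf hp _
    have n3 : 1 - e * p ^ n * p ^ k ≠ 0 :=
      one_sub_ne_zero_of_norm_lt_one (norm_mul_pow_lt_one hf hp k)
    rw [show k + (n + 1) = n + (k + 1) by ring, qPoch_add e, qPoch_succ (e * p ^ n)]
    generalize qPoch (a * b * p ^ k) p (n + 1) = Y
    generalize 1 - e * p ^ n * p ^ k = D at *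
    field_simp
  have hprod : ∏ i ∈ Finset.range (n + 1), (e * p ^ n - a * b * p ^ i) =
      (a * b) ^ (n + 1) * ∏ i ∈ Finset.range (n + 1), (c * d * p ^ n - p ^ i) := by
    have hpow : (a * b) ^ (n + 1) = ∏ _i ∈ Finset.range (n + 1), a * b := by simp
    rw [hpow, ← Finset.prod_mul_distrib]
    refine Finset.prod_congr rfl fun i _ => ?_
    rw [hfe]; ring
  have n4 : qPoch (e * p ^ n) p (n + 2) ≠ 0 := qPoch_ne_zero hf hp _
  rw [hsum, hprod, show 2 * (n + 1) = n + (n + 2) by ring, qPoch_add e,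
    ← termCoeff_self_mul hp0 hp n (c * d), mul_pow]
  generalize qPoch (e * p ^ n) p (n + 2) = Y at *
  generalize qPoch e p n = Z at *
  field_simp

/-- The squared norms of the Askey–Wilson polynomials. -/
theorem functional_askeyWilson_sq (hp0 : p ≠ 0) (hp : ‖p‖ < 1) (ha0 : a ≠ 0) (hb0 : b ≠ 0)
    (hc0 : c ≠ 0) (hd0 : d ≠ 0) (hab : ‖a * b‖ < 1)
    (hac : ‖a * c‖ < 1) (had : ‖a * d‖ < 1) (he : ‖a * b * c * d‖ < 1)
    (hΛ : HasProductMoments Λ p a b c d) (n : ℕ) :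
    Λ (askeyWilson n a b c d p * askeyWilson n a b c d p) * qPoch (a * b * c * d) p (2 * n) =
      Λ 1 * (qPoch p p n * (qPoch (a * b) p n * qPoch (a * c) p n * qPoch (a * d) p n *
          qPoch (b * c) p n * qPoch (b * d) p n * qPoch (c * d) p n) *
        qPoch (a * b * c * d * p ^ ((n : ℤ) - 1)) p n) := by
  cases n with
  | zero => simp [askeyWilson_zero]
  | succ n =>
    have hπ : ∏ j ∈ Finset.range (n + 1), (-2 * p ^ j) ≠ 0 :=
      Finset.prod_ne_zero_iff.2 fun j _ => mul_ne_zero (by norm_num) (pow_ne_zero j hp0)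
    have h1 := functional_mul_coeff (T := pairPoly b p) (degree_pairPoly_le b p)
      (fun j => by
        rw [coeff_pairPoly]
        exact mul_ne_zero (pow_ne_zero j hb0)
          (Finset.prod_ne_zero_iff.2 fun j _ => mul_ne_zero (by norm_num) (pow_ne_zero j hp0)))
      (fun j hj => functional_askeyWilson_mul_eq_zero hp0 hp hab hac had he hΛ hj)
      (degree_askeyWilson_le (n + 1) a b c d p)
    have h2 := functional_askeyWilson_mul_self hp0 hp ha0 hb0 hc0 hd0 hab hac had he hΛ n
    rw [coeff_pairPoly, coeff_askeyWilson_succ hp ha0 hab hac had] at h1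
    have ez : p ^ (((n + 1 : ℕ) : ℤ) - 1) = p ^ n := by simp
    rw [ez]
    refine mul_right_cancel₀ (mul_ne_zero (pow_ne_zero (n + 1) hb0) hπ) ?_
    linear_combination qPoch (a * b * c * d) p (2 * (n + 1)) * h1 +
      (qPoch (a * b * c * d * p ^ n) p (n + 1) * ∏ j ∈ Finset.range (n + 1), (-2 * p ^ j)) * h2

/-- Orthogonality of the Askey–Wilson polynomials. -/
theorem functional_askeyWilson_mul_of_ne (hp0 : p ≠ 0) (hp : ‖p‖ < 1) (hb0 : b ≠ 0)
    (hab : ‖a * b‖ < 1) (hac : ‖a * c‖ < 1) (had : ‖a * d‖ < 1) (he : ‖a * b * c * d‖ < 1)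
    (hΛ : HasProductMoments Λ p a b c d) {m n : ℕ} (hmn : m ≠ n) :
    Λ (askeyWilson m a b c d p * askeyWilson n a b c d p) = 0 := by
  wlog h : n < m generalizing m n
  · rw [mul_comm]
    exact this hmn.symm (by omega)
  refine functional_eq_zero_of_degree_lt (T := pairPoly b p) (degree_pairPoly_le b p) (fun j => ?_)
    (fun j hj => functional_askeyWilson_mul_eq_zero hp0 hp hab hac had he hΛ hj)
    ((degree_askeyWilson_le n a b c d p).trans_lt (by exact_mod_cast h))
  rw [coeff_pairPoly]
  exact mul_ne_zero (pow_ne_zero j hb0)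
    (Finset.prod_ne_zero_iff.2 fun j _ => mul_ne_zero (by norm_num) (pow_ne_zero j hp0))

end moments

/-! ### Moments of the Askey–Wilson weight -/

theorem awMean_add {p b c d : ℂ} (hp0 : p ≠ 0) (hp : ‖p‖ < 1) (hb : ‖b‖ < 1) (hc : ‖c‖ < 1)
    (hd : ‖d‖ < 1) (m k : ℕ) :
    awMean p (m + k) b c d * qPoch (p ^ m * b * c * d) p k =
      awMean p m b c d * (qPoch (p ^ m * b) p k * qPoch (p ^ m * c) p k *
        qPoch (p ^ m * d) p k) := by
  induction k with
  | zero => simp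
  | succ k ih =>
    have h := awMean_succ hp0 hp hb hc hd (m + k)
    have r (x : ℂ) : p ^ (m + k) * x = p ^ m * x * p ^ k := by ring
    rw [r, r, r, show p ^ m * b * p ^ k * c * d = p ^ m * b * c * d * p ^ k by ring] at h
    simp only [qPoch_succ, ← add_assoc]
    linear_combination qPoch (p ^ m * b * c * d) p k * h + (1 - p ^ m * b * p ^ k) *
      (1 - p ^ m * c * p ^ k) * (1 - p ^ m * d * p ^ k) * ih

theorem awMean_mul_pow {p b c d : ℂ} (hp0 : p ≠ 0) (hp : ‖p‖ < 1) (hb : ‖b‖ < 1) (hc : ‖c‖ < 1)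
    (hd : ‖d‖ < 1) (m j : ℕ) :
    awMean p m (b * p ^ j) c d * qPoch (p ^ m * b * c * d) p j =
      awMean p m b c d * (qPoch (p ^ m * b) p j * qPoch (b * c) p j * qPoch (b * d) p j) := by
  induction j with
  | zero => simp
  | succ j ih =>
    have h := awMean_mul_right hp0 hp (norm_mul_pow_lt_one hb hp j) hc hd m
    rw [show p ^ m * (b * p ^ j) * c * d = p ^ m * b * c * d * p ^ j by ring,
      mul_assoc b, ← pow_succ, ← mul_assoc (p ^ m), mul_right_comm b _ c,
      mul_right_comm b _ d] at h
    simp only [qPoch_succ]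
    linear_combination qPoch (p ^ m * b * c * d) p j * h + (1 - p ^ m * b * p ^ j) *
      (1 - b * c * p ^ j) * (1 - b * d * p ^ j) * ih

theorem awWeight_mul_pow {p b c d z : ℂ} (hp : ‖p‖ < 1) (hb : ‖b‖ < 1) (hz : ‖z‖ = 1) (j : ℕ) :
    awWeight p (b * p ^ j) c d z = awWeight p b c d z * pairPoch p b z j := by
  induction j with
  | zero => simp
  | succ j ih =>
    rw [pow_succ, ← mul_assoc, awWeight_mul_right hp (norm_mul_pow_lt_one hb hp j) hz, ih,
      pairPoch_succ]
    ring

theorem pairPoch_add (p t z : ℂ) (m k : ℕ) :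
    pairPoch p t z (m + k) = pairPoch p t z m * pairPoch p (t * p ^ m) z k := by
  simp only [pairPoch, qPoch_add, mul_right_comm t _ (p ^ m)]
  ring

/-- The functional `f ↦ ∮ f((z + z⁻¹)/2) W(z) dz/(2πiz)` over the unit circle. -/
noncomputable def circleFunctional (W : ℂ → ℂ) (hW : ContinuousOn W (sphere 0 1)) :
    ℂ[X] →ₗ[ℂ] ℂ where
  toFun f := circleAverage (fun z => W z * f.eval ((z + z⁻¹) / 2)) 0 1
  map_add' f g := by
    have hi := continuousOn_inv_sphere
    have h (f : ℂ[X]) : CircleIntegrable (fun z => W z * f.eval ((z + z⁻¹) / 2)) 0 1 :=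
      (hW.mul (f.continuous.comp_continuousOn (by fun_prop))).circleIntegrable zero_le_one
    rw [← circleAverage_fun_add (h f) (h g)]
    simp only [eval_add, mul_add]
  map_smul' a f := by
    simp only [eval_smul, smul_eq_mul, RingHom.id_apply, ← circleAverage_const_mul]
    congr 1 with z
    ring

/-- The functional of the Askey–Wilson weight with parameters `p ^ m, b, c, d`. -/
noncomputable def awFunctional {p b c d : ℂ} (hp : ‖p‖ < 1) (hb : ‖b‖ < 1) (hc : ‖c‖ < 1)
    (hd : ‖d‖ < 1) (m : ℕ) : ℂ[X] →ₗ[ℂ] ℂ :=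
  circleFunctional (fun z => pairPoch p 1 z m * awWeight p b c d z)
    (continuousOn_pairPoch_mul_awWeight hp hb hc hd 1 m)

theorem awFunctional_apply {p b c d : ℂ} (hp : ‖p‖ < 1) (hb : ‖b‖ < 1) (hc : ‖c‖ < 1)
    (hd : ‖d‖ < 1) (m : ℕ) (f : ℂ[X]) :
    awFunctional hp hb hc hd m f = circleAverage (fun z =>
      pairPoch p 1 z m * awWeight p b c d z * f.eval ((z + z⁻¹) / 2)) 0 1 := rfl

theorem awFunctional_one {p b c d : ℂ} (hp : ‖p‖ < 1) (hb : ‖b‖ < 1) (hc : ‖c‖ < 1)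
    (hd : ‖d‖ < 1) (m : ℕ) : awFunctional hp hb hc hd m 1 = awMean p m b c d := by
  simp [awFunctional_apply, awMean]

theorem hasProductMoments_awFunctional {p b c d : ℂ} (hp0 : p ≠ 0) (hp : ‖p‖ < 1) (hb : ‖b‖ < 1)
    (hc : ‖c‖ < 1) (hd : ‖d‖ < 1) (m : ℕ) :
    HasProductMoments (awFunctional hp hb hc hd m) p (p ^ m) b c d := by
  intro k j
  have h1 : awFunctional hp hb hc hd m (pairPoly (p ^ m) p k * pairPoly b p j) =
      awMean p (m + k) (b * p ^ j) c d := by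
    rw [awFunctional_apply, awMean]
    refine circleAverage_congr_sphere fun z hz => ?_
    have hz1 : ‖z‖ = 1 := by simpa using hz
    have hz0 : z ≠ 0 := norm_pos_iff.1 (by simp [hz1])
    simp only [eval_mul, eval_pairPoly _ _ _ hz0, awWeight_mul_pow hp hb hz1, pairPoch_add,
      one_mul]
    ring
  have h2 := awMean_mul_pow hp0 hp hb hc hd (m + k) j
  have h3 := awMean_add hp0 hp hb hc hd m k
  rw [show p ^ (m + k) * b * c * d = p ^ m * b * c * d * p ^ k by ring,
    show p ^ (m + k) * b = p ^ m * b * p ^ k by ring] at h2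
  rw [h1, awFunctional_one, qPoch_add, qPoch_add]
  linear_combination qPoch (p ^ m * b * c * d) p k * h2 +
    qPoch (p ^ m * b * p ^ k) p j * qPoch (b * c) p j * qPoch (b * d) p j * h3

/-! ### Reduction of the Laurent form to the Askey–Wilson functionals -/

/-- The weight of the Laurent form with its removable singularities removed. -/
noncomputable def regWeight (q b z : ℂ) : ℂ :=
  (1 + z⁻¹) * core (q ^ 3) (q ^ 3) b (b * q) (b * q ^ 2) z

theorem weight_eq_regWeight {q b z : ℂ} (hq : ‖q‖ < 1) (hz : ‖z‖ = 1) (h1 : z ≠ 1)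
    (h2 : z ≠ -1) : weight q b z = regWeight q b z := by
  have hp : ‖q ^ 3‖ < 1 := norm_pow_lt_one hq three_ne_zero
  have hz0 : z ≠ 0 := norm_pos_iff.1 (by simp [hz])
  have n1 : 1 - z ≠ 0 := sub_ne_zero.2 h1.symm
  have n2 : 1 - z⁻¹ ≠ 0 := sub_ne_zero.2 fun h => h1 (inv_eq_one.1 h.symm)
  have n3 : 1 + z ≠ 0 := fun h => h2 (by linear_combination h)
  have e (x : ℂ) : qPochInf x (q ^ 3) = (1 - x) * qPochInf (q ^ 3 * x) (q ^ 3) := by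
    rw [qPochInf_eq_one_sub_mul x hp, mul_comm x]
  have e3 (x : ℂ) : qPochInf (b * x) q = qPochInf (b * x) (q ^ 3) *
      qPochInf (b * q * x) (q ^ 3) * qPochInf (b * q ^ 2 * x) (q ^ 3) := by
    rw [qPochInf_dissect_three _ hq, mul_right_comm b q, mul_right_comm b (q ^ 2)]
  have e4 : (1 - z ^ 2) * (1 - z⁻¹ ^ 2) / ((1 - z) * (1 - z⁻¹)) * (1 / (1 + z)) = 1 + z⁻¹ := by
    have e5 : (1 - z ^ 2) * (1 - z⁻¹ ^ 2) = (1 - z) * (1 - z⁻¹) * (1 + z) * (1 + z⁻¹) := by ring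
    rw [e5]
    generalize 1 - z⁻¹ = y at *
    field_simp
  rw [weight, e (z ^ 2), e (z⁻¹ ^ 2), e z, e z⁻¹, e3, e3, regWeight, core, ← e4]
  simp only [pairInf, div_eq_mul_inv, mul_inv]
  ring

theorem continuousOn_laurentEval (f : ℂ[T;T⁻¹]) :
    ContinuousOn (fun z => laurentEval z f) (sphere 0 1) := by
  unfold laurentEval Finsupp.sum
  refine continuousOn_finsetSum _ fun k _ => continuousOn_const.mul ?_
  exact (continuousOn_id).zpow₀ k fun z hz => Or.inl (ne_of_mem_sphere hz one_ne_zero)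

theorem continuousOn_regWeight {q b : ℂ} (hq : ‖q‖ < 1) (hb : ‖b‖ < 1) :
    ContinuousOn (regWeight q b) (sphere 0 1) := by
  have hi := continuousOn_inv_sphere
  exact (continuousOn_const.add hi).mul (continuousOn_core_sphere
    (norm_pow_lt_one hq three_ne_zero) hb (norm_mul_lt_one hb hq)
    (norm_mul_pow_lt_one hb hq 2))

/-- The integrand and its regularization differ at most at `z = ±1`. -/
theorem integrand_eventuallyEq {q b : ℂ} (hq : ‖q‖ < 1) (f g : ℂ[T;T⁻¹]) :
    (fun z => z⁻¹ * (laurentEval z f * laurentEval z g * regWeight q b z))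
      =ᶠ[codiscreteWithin (sphere (0 : ℂ) |1|)] integrand q b f g := by
  rw [(isCompact_sphere (0 : ℂ) |1|).codiscreteWithin_eq]
  have h : ({1, -1} : Set ℂ)ᶜ ∈ cofinite := (Set.toFinite _).compl_mem_cofinite
  filter_upwards [mem_inf_of_left h, mem_inf_of_right (mem_principal_self _)] with z h1 h2
  simp only [Set.mem_compl_iff, Set.mem_insert_iff, Set.mem_singleton_iff, not_or] at h1
  rw [integrand, weight_eq_regWeight hq (by simpa using h2) h1.1 h1.2, div_eq_mul_inv]
  ring

theorem circleIntegrable_integrand {q b : ℂ} (hq : ‖q‖ < 1) (hb : ‖b‖ < 1) (f g : ℂ[T;T⁻¹]) :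
    CircleIntegrable (integrand q b f g) 0 1 :=
  CircleIntegrable.congr_codiscreteWithin (integrand_eventuallyEq hq f g)
    ((continuousOn_inv_sphere.mul (((continuousOn_laurentEval f).mul
      (continuousOn_laurentEval g)).mul (continuousOn_regWeight hq hb))).circleIntegrable
      zero_le_one)

/-- The normalizing factor of the form. -/
noncomputable def formConst (q b : ℂ) : ℂ :=
  qPochInf (q ^ 3) (q ^ 3) * (qPochInf b q * qPochInf (b ^ 2 * q) q) /
    qPochInf (b ^ 3 * q ^ 3) (q ^ 3)

theorem form_eq_circleAverage {q b : ℂ} (hq : ‖q‖ < 1) (f g : ℂ[T;T⁻¹]) :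
    form q b f g = formConst q b *
      circleAverage (fun z => laurentEval z f * laurentEval z g * regWeight q b z) 0 1 := by
  rw [form, formConst, circleAverage_eq_circleIntegral one_ne_zero,
    ← circleIntegral.circleIntegral_congr_codiscreteWithin (integrand_eventuallyEq hq f g)
      one_ne_zero]
  simp only [sub_zero, smul_eq_mul]

theorem form_eq_symmetrized {q b : ℂ} (hq : ‖q‖ < 1) (hb : ‖b‖ < 1) (f g : ℂ[T;T⁻¹]) :
    form q b f g = formConst q b / 2 * circleAverage (fun z =>
      (laurentEval z f * laurentEval z g * (1 + z⁻¹) +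
        laurentEval z⁻¹ f * laurentEval z⁻¹ g * (1 + z)) *
        core (q ^ 3) (q ^ 3) b (b * q) (b * q ^ 2) z) 0 1 := by
  have h := two_mul_circleAverage (((continuousOn_laurentEval f).mul
      (continuousOn_laurentEval g)).mul (continuousOn_regWeight hq hb))
  rw [form_eq_circleAverage hq, div_mul_eq_mul_div, eq_div_iff two_ne_zero, mul_assoc,
    mul_comm _ (2 : ℂ)]
  congr 1
  refine h.trans (circleAverage_congr_sphere fun z _ => ?_)
  simp only [Pi.mul_apply, regWeight, core_inv, inv_inv]
  ring

theorem laurentEval_pEven_inv (q b : ℂ) (n : ℕ) {z : ℂ} (hz : z ≠ 0) :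
    laurentEval z⁻¹ (pEven q b n) = laurentEval z (pEven q b n) := by
  rw [laurentEval_pEven _ _ _ hz, laurentEval_pEven _ _ _ (inv_ne_zero hz), inv_inv,
    add_comm z⁻¹]

/-- The factor `(z - 1)/(z + 1)` changes sign under `z ↦ z⁻¹`. -/
theorem form_pEven_pOdd {q b : ℂ} (hq : ‖q‖ < 1) (hb : ‖b‖ < 1) (m n : ℕ) :
    form q b (pEven q b m) (pOdd q b n) = 0 := by
  rw [form_eq_symmetrized hq hb, circleAverage_congr_sphere (f₂ := fun _ => 0), circleAverage_const,
    mul_zero]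
  intro z hz
  have hz0 : z ≠ 0 := ne_of_mem_sphere (by simpa using hz) one_ne_zero
  simp only [laurentEval_pEven_inv _ _ _ hz0]
  rw [laurentEval_pOdd _ _ _ hz0, laurentEval_pOdd _ _ _ (inv_ne_zero hz0), inv_inv,
    add_comm z⁻¹ z]
  field_simp
  ring

theorem form_comm (q b : ℂ) (f g : ℂ[T;T⁻¹]) : form q b f g = form q b g f := by
  simp only [form, integrand, mul_comm (laurentEval _ f)]

theorem form_pEven_pEven {q b : ℂ} (hq : ‖q‖ < 1) (hb : ‖b‖ < 1) (m n : ℕ) :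
    form q b (pEven q b m) (pEven q b n) = formConst q b / 2 *
      (1 / qPoch (b ^ 3 * q ^ (3 * m)) (q ^ 3) m * (1 / qPoch (b ^ 3 * q ^ (3 * n)) (q ^ 3) n) *
        awFunctional (norm_pow_lt_one hq three_ne_zero) hb (norm_mul_lt_one hb hq)
          (norm_mul_pow_lt_one hb hq 2) 0
          (askeyWilson m 1 b (b * q) (b * q ^ 2) (q ^ 3) *
            askeyWilson n 1 b (b * q) (b * q ^ 2) (q ^ 3))) := by
  rw [form_eq_symmetrized hq hb, awFunctional_apply]
  congr 1
  rw [← circleAverage_const_mul]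
  refine circleAverage_congr_sphere fun z hz => ?_
  have hz0 : z ≠ 0 := ne_of_mem_sphere (by simpa using hz) one_ne_zero
  have hzi : z * z⁻¹ = 1 := mul_inv_cancel₀ hz0
  simp only [laurentEval_pEven_inv _ _ _ hz0]
  rw [laurentEval_pEven _ _ _ hz0, laurentEval_pEven _ _ _ hz0, pairPoch_zero, awWeight, eval_mul,
    show (1 + z) * (1 + z⁻¹) = (1 + z⁻¹) + (1 + z) by linear_combination hzi]
  ring

/-- The factor `(z - 1)²/(1 + z)` symmetrizes to `-(1 - z)(1 - z⁻¹)`, hence the sign and the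
first parameter `q³`. -/
theorem form_pOdd_pOdd {q b : ℂ} (hq : ‖q‖ < 1) (hb : ‖b‖ < 1) (m n : ℕ) :
    form q b (pOdd q b m) (pOdd q b n) = -(formConst q b / 2) *
      (1 / qPoch (b ^ 3 * q ^ (3 * m + 3)) (q ^ 3) m *
        (1 / qPoch (b ^ 3 * q ^ (3 * n + 3)) (q ^ 3) n) *
        awFunctional (norm_pow_lt_one hq three_ne_zero) hb (norm_mul_lt_one hb hq)
          (norm_mul_pow_lt_one hb hq 2) 1
          (askeyWilson m (q ^ 3) b (b * q) (b * q ^ 2) (q ^ 3) *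
            askeyWilson n (q ^ 3) b (b * q) (b * q ^ 2) (q ^ 3))) := by
  rw [form_eq_symmetrized hq hb, awFunctional_apply, neg_mul, ← mul_neg]
  congr 1
  rw [← neg_mul, ← circleAverage_const_mul]
  refine circleAverage_congr_sphere fun z hz => ?_
  have hz0 : z ≠ 0 := ne_of_mem_sphere (by simpa using hz) one_ne_zero
  have e1 : (z - 1) ^ 2 * (1 + z⁻¹) + (z⁻¹ - 1) ^ 2 * (1 + z) =
      -((1 - z) * (1 - z⁻¹) * ((1 + z) * (1 + z⁻¹))) := by
    field_simp
    ring
  rw [laurentEval_pOdd _ _ _ hz0, laurentEval_pOdd _ _ _ hz0,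
    laurentEval_pOdd _ _ _ (inv_ne_zero hz0), laurentEval_pOdd _ _ _ (inv_ne_zero hz0), inv_inv,
    add_comm z⁻¹ z, pairPoch, qPoch_one, qPoch_one, one_mul, one_mul, awWeight, eval_mul]
  simp only [div_eq_mul_inv, one_mul]
  linear_combination (qPoch (b ^ 3 * q ^ (3 * m + 3)) (q ^ 3) m)⁻¹ *
    (qPoch (b ^ 3 * q ^ (3 * n + 3)) (q ^ 3) n)⁻¹ *
    core (q ^ 3) (q ^ 3) b (b * q) (b * q ^ 2) z *
    eval ((z + z⁻¹) * 2⁻¹) (askeyWilson m (q ^ 3) b (b * q) (b * q ^ 2) (q ^ 3)) *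
    eval ((z + z⁻¹) * 2⁻¹) (askeyWilson n (q ^ 3) b (b * q) (b * q ^ 2) (q ^ 3)) * e1

/-! ### The norms -/

theorem formConst_mul_awMean_zero {q b : ℂ} (hq0 : q ≠ 0) (hq : ‖q‖ < 1) (hb : ‖b‖ < 1) :
    formConst q b * awMean (q ^ 3) 0 b (b * q) (b * q ^ 2) = 2 := by
  have hp : ‖q ^ 3‖ < 1 := norm_pow_lt_one hq three_ne_zero
  have h := awMean_eq (pow_ne_zero 3 hq0) hp hb (norm_mul_lt_one hb hq)
    (norm_mul_pow_lt_one hb hq 2) 0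
  have e1 := qPochInf_dissect_three b hq
  have e2 := qPochInf_dissect_three (b ^ 2 * q) hq
  have he : ‖b ^ 3 * q ^ 3‖ < 1 := norm_mul_pow_lt_one (norm_pow_lt_one hb three_ne_zero) hq 3
  rw [pow_zero, one_mul, one_mul, one_mul, show b * (b * q) * (b * q ^ 2) = b ^ 3 * q ^ 3 by ring,
    show b * (b * q) = b ^ 2 * q by ring, show b * (b * q ^ 2) = b ^ 2 * q * q by ring,
    show b * q * (b * q ^ 2) = b ^ 2 * q * q ^ 2 by ring] at h
  rw [formConst, div_mul_eq_mul_div, div_eq_iff (qPochInf_ne_zero he hp), e1, e2, ← h]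
  ring

theorem formConst_mul_awMean_one {q b : ℂ} (hq0 : q ≠ 0) (hq : ‖q‖ < 1) (hb : ‖b‖ < 1) :
    formConst q b * awMean (q ^ 3) 1 b (b * q) (b * q ^ 2) * (1 - b ^ 3 * q ^ 3) =
      2 * ((1 - b) * (1 - b * q) * (1 - b * q ^ 2)) := by
  have h := awMean_succ (pow_ne_zero 3 hq0) (norm_pow_lt_one hq three_ne_zero) hb
    (norm_mul_lt_one hb hq) (norm_mul_pow_lt_one hb hq 2) 0
  rw [pow_zero, one_mul, one_mul, one_mul, zero_add,
    show b * (b * q) * (b * q ^ 2) = b ^ 3 * q ^ 3 by ring] at h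
  have h0 := formConst_mul_awMean_zero hq0 hq hb
  linear_combination formConst q b * h + (1 - b) * (1 - b * q) * (1 - b * q ^ 2) * h0

theorem omega_pow_three : omega ^ 3 = 1 := by
  rw [omega, ← Complex.exp_nat_mul]
  convert Complex.exp_two_pi_mul_I using 2
  push_cast
  ring

theorem norm_omega : ‖omega‖ = 1 :=
  (pow_eq_one_iff_of_nonneg (norm_nonneg _) three_ne_zero).1 (by
    rw [← norm_pow, omega_pow_three, norm_one])

theorem omega_sum : 1 + omega + omega ^ 2 = 0 := by
  have h : omega ≠ 1 := by
    have := Complex.isPrimitiveRoot_exp 3 three_ne_zero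
    have h2 := this.ne_one (by norm_num)
    simpa [omega] using h2
  have h3 : (omega - 1) * (1 + omega + omega ^ 2) = 0 := by
    linear_combination omega_pow_three
  exact (mul_eq_zero.1 h3).resolve_left (sub_ne_zero.2 h)

theorem omega_factor (x : ℂ) :
    (1 - x) * ((1 - omega * x) * (1 - omega ^ 2 * x)) = 1 - x ^ 3 := by
  linear_combination -(1 - x) * x * omega_sum + (1 - x) * x ^ 2 * omega_pow_three

theorem form_pEven_self {q b : ℂ} (hq0 : q ≠ 0) (hq : ‖q‖ < 1) (hb0 : b ≠ 0) (hb : ‖b‖ < 1)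
    (n : ℕ) : form q b (pEven q b n) (pEven q b n) = hEven q b n := by
  have hp0 : q ^ 3 ≠ 0 := pow_ne_zero 3 hq0
  have hp : ‖q ^ 3‖ < 1 := norm_pow_lt_one hq three_ne_zero
  have hc := norm_mul_lt_one hb hq
  have hd := norm_mul_pow_lt_one hb hq 2
  have hb3 : ‖b ^ 3‖ < 1 := norm_pow_lt_one hb three_ne_zero
  have hM := hasProductMoments_awFunctional hp0 hp hb hc hd 0
  rw [pow_zero] at hM
  have h := functional_askeyWilson_sq hp0 hp one_ne_zero hb0 (mul_ne_zero hb0 hq0)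
    (mul_ne_zero hb0 (pow_ne_zero 2 hq0)) (by simpa using hb) (by simpa using hc)
    (by simpa using hd) (by simpa using norm_mul_lt_one (norm_mul_lt_one hb hc) hd) hM n
  have hC := formConst_mul_awMean_zero hq0 hq hb
  have ee : 1 * b * (b * q) * (b * q ^ 2) = b ^ 3 * q ^ 3 := by ring
  have ez : b ^ 3 * q ^ 3 * (q ^ 3) ^ ((n : ℤ) - 1) = b ^ 3 * q ^ (3 * n) := by
    rw [zpow_sub_one₀ hp0, zpow_natCast, ← pow_mul]
    field_simp
  rw [awFunctional_one, ee, ez, one_mul, one_mul, one_mul, show b * (b * q) = b ^ 2 * q by ring,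
    show b * (b * q ^ 2) = b ^ 2 * q * q by ring,
    show b * q * (b * q ^ 2) = b ^ 2 * q * q ^ 2 by ring] at h
  have n1 : qPoch (b ^ 3 * q ^ (3 * n)) (q ^ 3) n ≠ 0 :=
    qPoch_ne_zero (norm_mul_pow_lt_one hb3 hq _) hp n
  have n2 : qPoch (b ^ 3 * q ^ 3) (q ^ 3) (2 * n) ≠ 0 :=
    qPoch_ne_zero (norm_mul_pow_lt_one hb3 hq _) hp _
  have n3 : qPoch (b ^ 3) (q ^ 3) n ≠ 0 := qPoch_ne_zero hb3 hp _
  have e1 : qPoch (b ^ 3) (q ^ 3) (2 * n) =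
      qPoch (b ^ 3) (q ^ 3) n * qPoch (b ^ 3 * q ^ (3 * n)) (q ^ 3) n := by
    rw [two_mul, qPoch_add, ← pow_mul]
  rw [form_pEven_pEven hq hb, eq_div_of_mul_eq n2 h, hEven, e1, qPoch_three_mul b,
    qPoch_three_mul (b ^ 2 * q)]
  field_simp
  linear_combination (qPoch (q ^ 3) (q ^ 3) n * qPoch b (q ^ 3) n * qPoch (b * q) (q ^ 3) n *
    qPoch (b * q ^ 2) (q ^ 3) n * qPoch (b ^ 2 * q) (q ^ 3) n * qPoch (b ^ 2 * q ^ 2) (q ^ 3) n *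
    qPoch (b ^ 2 * q ^ 3) (q ^ 3) n) * hC

theorem form_pOdd_self {q b : ℂ} (hq0 : q ≠ 0) (hq : ‖q‖ < 1) (hb0 : b ≠ 0) (hb : ‖b‖ < 1)
    (n : ℕ) : form q b (pOdd q b n) (pOdd q b n) = hOdd q b n := by
  have hp0 : q ^ 3 ≠ 0 := pow_ne_zero 3 hq0
  have hp : ‖q ^ 3‖ < 1 := norm_pow_lt_one hq three_ne_zero
  have hc := norm_mul_lt_one hb hq
  have hd := norm_mul_pow_lt_one hb hq 2
  have hb3 : ‖b ^ 3‖ < 1 := norm_pow_lt_one hb three_ne_zero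
  have hM := hasProductMoments_awFunctional hp0 hp hb hc hd 1
  rw [pow_one] at hM
  have h := functional_askeyWilson_sq hp0 hp hp0 hb0 (mul_ne_zero hb0 hq0)
    (mul_ne_zero hb0 (pow_ne_zero 2 hq0)) (norm_mul_lt_one hp hb) (norm_mul_lt_one hp hc)
    (norm_mul_lt_one hp hd) (norm_mul_lt_one (norm_mul_lt_one (norm_mul_lt_one hp hb) hc) hd) hM n
  have hC := formConst_mul_awMean_one hq0 hq hb
  have hω := omega_factor (b * q)
  have ee : q ^ 3 * b * (b * q) * (b * q ^ 2) = b ^ 3 * q ^ 6 := by ring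
  have ez : b ^ 3 * q ^ 6 * (q ^ 3) ^ ((n : ℤ) - 1) = b ^ 3 * q ^ (3 * n + 3) := by
    rw [zpow_sub_one₀ hp0, zpow_natCast, ← pow_mul, pow_add]
    field_simp
  rw [awFunctional_one, ee, ez, show b * (b * q) = b ^ 2 * q by ring,
    show b * (b * q ^ 2) = b ^ 2 * q * q by ring,
    show b * q * (b * q ^ 2) = b ^ 2 * q * q ^ 2 by ring,
    show q ^ 3 * b = b * q ^ 3 by ring, show q ^ 3 * (b * q) = b * q ^ 3 * q by ring,
    show q ^ 3 * (b * q ^ 2) = b * q ^ 3 * q ^ 2 by ring] at h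
  have n1 : qPoch (b ^ 3 * q ^ (3 * n + 3)) (q ^ 3) n ≠ 0 :=
    qPoch_ne_zero (norm_mul_pow_lt_one hb3 hq _) hp n
  have n2 : qPoch (b ^ 3 * q ^ 6) (q ^ 3) (2 * n) ≠ 0 :=
    qPoch_ne_zero (norm_mul_pow_lt_one hb3 hq _) hp _
  have n3 : qPoch (b ^ 3 * q ^ 3) (q ^ 3) n ≠ 0 :=
    qPoch_ne_zero (norm_mul_pow_lt_one hb3 hq _) hp _
  have n4 : 1 - b * q ≠ 0 := one_sub_ne_zero_of_norm_lt_one hc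
  have n5 : 1 - b ^ 3 * q ^ 3 ≠ 0 :=
    one_sub_ne_zero_of_norm_lt_one (norm_mul_pow_lt_one hb3 hq 3)
  rw [mul_pow] at hω
  have n6 : (1 - omega * (b * q)) * (1 - omega ^ 2 * (b * q)) ≠ 0 := by
    rw [← hω] at n5
    exact right_ne_zero_of_mul n5
  have e1 : qPoch (b ^ 3 * q ^ 3) (q ^ 3) (2 * n) =
      qPoch (b ^ 3 * q ^ 3) (q ^ 3) n * qPoch (b ^ 3 * q ^ (3 * n + 3)) (q ^ 3) n := by
    rw [two_mul, qPoch_add, ← pow_mul, mul_assoc, ← pow_add, add_comm 3]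
  have hK : (1 - b) * (1 - b * q ^ 2) / ((1 - omega * b * q) * (1 - omega ^ 2 * b * q)) =
      formConst q b * awMean (q ^ 3) 1 b (b * q) (b * q ^ 2) / 2 := by
    rw [mul_assoc omega, mul_assoc (omega ^ 2), div_eq_div_iff n6 two_ne_zero]
    refine mul_right_cancel₀ n4 ?_
    linear_combination (-formConst q b * awMean (q ^ 3) 1 b (b * q) (b * q ^ 2)) * hω - hC
  rw [form_pOdd_pOdd hq hb, eq_div_of_mul_eq n2 h, hOdd, hK, e1, qPoch_three_mul (b * q ^ 3),
    qPoch_three_mul (b ^ 2 * q)]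
  field_simp

theorem form_pEven_of_ne {q b : ℂ} (hq0 : q ≠ 0) (hq : ‖q‖ < 1) (hb0 : b ≠ 0) (hb : ‖b‖ < 1)
    {m n : ℕ} (hmn : m ≠ n) : form q b (pEven q b m) (pEven q b n) = 0 := by
  have hp0 : q ^ 3 ≠ 0 := pow_ne_zero 3 hq0
  have hp : ‖q ^ 3‖ < 1 := norm_pow_lt_one hq three_ne_zero
  have hc := norm_mul_lt_one hb hq
  have hd := norm_mul_pow_lt_one hb hq 2
  have hM := hasProductMoments_awFunctional hp0 hp hb hc hd 0
  rw [pow_zero] at hM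
  rw [form_pEven_pEven hq hb, functional_askeyWilson_mul_of_ne hp0 hp hb0 (by simpa using hb)
    (by simpa using hc) (by simpa using hd)
    (by simpa using norm_mul_lt_one (norm_mul_lt_one hb hc) hd) hM hmn, mul_zero, mul_zero]

theorem form_pOdd_of_ne {q b : ℂ} (hq0 : q ≠ 0) (hq : ‖q‖ < 1) (hb0 : b ≠ 0) (hb : ‖b‖ < 1)
    {m n : ℕ} (hmn : m ≠ n) : form q b (pOdd q b m) (pOdd q b n) = 0 := by
  have hp0 : q ^ 3 ≠ 0 := pow_ne_zero 3 hq0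
  have hp : ‖q ^ 3‖ < 1 := norm_pow_lt_one hq three_ne_zero
  have hc := norm_mul_lt_one hb hq
  have hd := norm_mul_pow_lt_one hb hq 2
  have hM := hasProductMoments_awFunctional hp0 hp hb hc hd 1
  rw [pow_one] at hM
  rw [form_pOdd_pOdd hq hb, functional_askeyWilson_mul_of_ne hp0 hp hb0 (norm_mul_lt_one hp hb)
    (norm_mul_lt_one hp hc) (norm_mul_lt_one hp hd)
    (norm_mul_lt_one (norm_mul_lt_one (norm_mul_lt_one hp hb) hc) hd) hM hmn, mul_zero, mul_zero]

/-- Orthogonality for `b ≠ 0`, when the products `(bz, b/z; q³)_j` span the symmetric Laurent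
polynomials. -/
theorem form_pLaurent_of_ne_zero {q b : ℂ} (hq0 : q ≠ 0) (hq : ‖q‖ < 1) (hb0 : b ≠ 0)
    (hb : ‖b‖ < 1) (m n : ℕ) :
    form q b (pLaurent q b m) (pLaurent q b n) = if m = n then hNorm q b m else 0 := by
  rcases Nat.even_or_odd' m with ⟨k, rfl | rfl⟩ <;> rcases Nat.even_or_odd' n with ⟨l, rfl | rfl⟩
  · by_cases h : k = l
    · subst h
      simp [pLaurent, hNorm, form_pEven_self hq0 hq hb0 hb]
    · simp [pLaurent, h, form_pEven_of_ne hq0 hq hb0 hb h]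
  · have h : ¬ 2 * k = 2 * l + 1 := by omega
    simp [pLaurent, h, form_pEven_pOdd hq hb]
  · have h : ¬ 2 * k + 1 = 2 * l := by omega
    simp [pLaurent, h, form_comm q b (pOdd q b _), form_pEven_pOdd hq hb]
  · have e (j : ℕ) : (2 * j + 1) / 2 = j := by omega
    by_cases h : k = l
    · subst h
      simp [pLaurent, hNorm, e, form_pOdd_self hq0 hq hb0 hb]
    · simp [pLaurent, h, e, form_pOdd_of_ne hq0 hq hb0 hb h]

/-! ### Continuity in the parameter `b` -/

section continuity

variable {X : Type*} [TopologicalSpace X] {s : Set X}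

@[fun_prop]
theorem continuousOn_qPoch {F : X → ℂ} (hF : ContinuousOn F s) (q : ℂ) (n : ℕ) :
    ContinuousOn (fun x => qPoch (F x) q n) s := by
  unfold qPoch
  fun_prop

theorem continuousOn_qPochInf {F : X → ℂ} (hF : ContinuousOn F s) {q : ℂ} (hq : ‖q‖ < 1) :
    ContinuousOn (fun x => qPochInf (F x) q) s :=
  (continuous_qPochInf hq).comp_continuousOn hF

theorem continuousOn_eval_askeyWilson {p a : ℂ} (hp : ‖p‖ < 1) (ha0 : a ≠ 0) (ha : ‖a‖ ≤ 1)
    {B C D Y : X → ℂ} (hB : ContinuousOn B s) (hC : ContinuousOn C s) (hD : ContinuousOn D s)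
    (hY : ContinuousOn Y s) (hB1 : ∀ x ∈ s, ‖B x‖ < 1) (hC1 : ∀ x ∈ s, ‖C x‖ < 1)
    (hD1 : ∀ x ∈ s, ‖D x‖ < 1) (n : ℕ) :
    ContinuousOn (fun x => (askeyWilson n a (B x) (C x) (D x) p).eval (Y x)) s := by
  have hn {t : ℂ} (ht : ‖t‖ < 1) (k : ℕ) : qPoch (a * t) p k ≠ 0 := by
    refine qPoch_ne_zero ?_ hp k
    rw [norm_mul]
    exact (mul_le_of_le_one_left (norm_nonneg t) ha).trans_lt ht
  simp only [askeyWilson, eval_mul, eval_C, eval_finsetSum, eval_prod, eval_add, eval_sub,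
    eval_one, eval_X]
  refine ContinuousOn.mul (ContinuousOn.div (by fun_prop) (by fun_prop)
    fun x hx => pow_ne_zero n ha0) (continuousOn_finsetSum _ fun k _ => ?_)
  refine ContinuousOn.mul (ContinuousOn.mul (ContinuousOn.div (by fun_prop) (by fun_prop)
    fun x hx => ?_) (by fun_prop)) (by fun_prop)
  exact mul_ne_zero (mul_ne_zero (mul_ne_zero (qPoch_ne_zero hp hp k) (hn (hB1 x hx) k))
    (hn (hC1 x hx) k)) (hn (hD1 x hx) k)

end continuity

theorem continuousOn_laurentEval_pLaurent {q : ℂ} (hq0 : q ≠ 0) (hq : ‖q‖ < 1) (m : ℕ) :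
    ContinuousOn (fun x : ℂ × ℂ => laurentEval x.2 (pLaurent q x.1 m))
      (ball 0 1 ×ˢ sphere 0 1) := by
  have hp : ‖q ^ 3‖ < 1 := norm_pow_lt_one hq three_ne_zero
  have hi : ContinuousOn (fun x : ℂ × ℂ => x.2⁻¹) (ball 0 1 ×ˢ sphere 0 1) :=
    continuousOn_snd.inv₀ fun x hx => ne_of_mem_sphere hx.2 one_ne_zero
  have hb {x : ℂ × ℂ} (hx : x ∈ ball (0 : ℂ) 1 ×ˢ sphere (0 : ℂ) 1) : ‖x.1‖ < 1 := by
    simpa using hx.1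
  have hz {x : ℂ × ℂ} (hx : x ∈ ball (0 : ℂ) 1 ×ˢ sphere (0 : ℂ) 1) : x.2 ≠ 0 :=
    ne_of_mem_sphere hx.2 one_ne_zero
  have hP {a : ℂ} (ha0 : a ≠ 0) (ha : ‖a‖ ≤ 1) (n : ℕ) : ContinuousOn (fun x : ℂ × ℂ =>
      (askeyWilson n a x.1 (x.1 * q) (x.1 * q ^ 2) (q ^ 3)).eval ((x.2 + x.2⁻¹) / 2))
      (ball 0 1 ×ˢ sphere 0 1) :=
    continuousOn_eval_askeyWilson hp ha0 ha (by fun_prop) (by fun_prop) (by fun_prop)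
      (by fun_prop) (fun x hx => hb hx) (fun x hx => norm_mul_lt_one (hb hx) hq)
      (fun x hx => norm_mul_pow_lt_one (hb hx) hq 2) n
  have hden {x : ℂ × ℂ} (hx : x ∈ ball (0 : ℂ) 1 ×ˢ sphere (0 : ℂ) 1) (k n : ℕ) :
      qPoch (x.1 ^ 3 * q ^ k) (q ^ 3) n ≠ 0 :=
    qPoch_ne_zero (norm_mul_pow_lt_one (norm_pow_lt_one (hb hx) three_ne_zero) hq k) hp n
  unfold pLaurent
  split_ifs
  · refine ContinuousOn.congr (f := fun x : ℂ × ℂ => _) ?_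
      fun x hx => laurentEval_pEven q x.1 (m / 2) (hz hx)
    exact (ContinuousOn.div (by fun_prop) (by fun_prop) fun x hx => hden hx _ _).mul
      (hP one_ne_zero (by simp) _)
  · refine ContinuousOn.congr (f := fun x : ℂ × ℂ => _) ?_
      fun x hx => laurentEval_pOdd q x.1 (m / 2) (hz hx)
    exact (ContinuousOn.div (by fun_prop) (by fun_prop) fun x hx => hden hx _ _).mul
      (hP (pow_ne_zero 3 hq0) hp.le _)

theorem continuousOn_form_pLaurent {q : ℂ} (hq0 : q ≠ 0) (hq : ‖q‖ < 1) (m n : ℕ) :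
    ContinuousOn (fun b => form q b (pLaurent q b m) (pLaurent q b n)) (ball 0 1) := by
  have hp : ‖q ^ 3‖ < 1 := norm_pow_lt_one hq three_ne_zero
  have hi : ContinuousOn (fun x : ℂ × ℂ => x.2⁻¹) (ball 0 1 ×ˢ sphere 0 1) :=
    continuousOn_snd.inv₀ fun x hx => ne_of_mem_sphere hx.2 one_ne_zero
  have hb {x : ℂ × ℂ} (hx : x ∈ ball (0 : ℂ) 1 ×ˢ sphere (0 : ℂ) 1) : ‖x.1‖ < 1 := by
    simpa using hx.1
  simp only [form_eq_circleAverage hq]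
  refine ContinuousOn.mul ?_ (continuousOn_circleAverage (F := fun b z =>
    laurentEval z (pLaurent q b m) * laurentEval z (pLaurent q b n) * regWeight q b z) ?_)
  · unfold formConst
    refine ContinuousOn.div (continuousOn_const.mul ((continuousOn_qPochInf (by fun_prop) hq).mul
      (continuousOn_qPochInf (by fun_prop) hq))) (continuousOn_qPochInf (by fun_prop) hp)
      fun b hb => ?_
    exact qPochInf_ne_zero (norm_mul_pow_lt_one
      (norm_pow_lt_one (by simpa using hb) three_ne_zero) hq 3) hp
  · refine ((continuousOn_laurentEval_pLaurent hq0 hq m).mul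
      (continuousOn_laurentEval_pLaurent hq0 hq n)).mul ((continuousOn_const.add hi).mul ?_)
    exact continuousOn_core hp (by fun_prop) (by fun_prop) (by fun_prop) (by fun_prop)
      continuousOn_snd (fun _ _ => hp) (fun x hx => hb hx)
      (fun x hx => norm_mul_lt_one (hb hx) hq)
      (fun x hx => norm_mul_pow_lt_one (hb hx) hq 2) (fun x hx => by simpa using hx.2)

theorem continuousOn_hNorm {q : ℂ} (hq : ‖q‖ < 1) (m : ℕ) :
    ContinuousOn (fun b => hNorm q b m) (ball 0 1) := by
  have hp : ‖q ^ 3‖ < 1 := norm_pow_lt_one hq three_ne_zero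
  have hne {b : ℂ} (hb : b ∈ ball (0 : ℂ) 1) (k n : ℕ) : qPoch (b ^ 3 * q ^ k) (q ^ 3) n ≠ 0 :=
    qPoch_ne_zero (norm_mul_pow_lt_one (norm_pow_lt_one (by simpa using hb) three_ne_zero) hq k)
      hp n
  unfold hNorm
  split_ifs
  · unfold hEven
    refine ContinuousOn.div (by fun_prop) (by fun_prop) fun b hb => mul_ne_zero ?_ (hne hb _ _)
    simpa using hne hb 0 (2 * (m / 2))
  · unfold hOdd
    refine ContinuousOn.mul (ContinuousOn.neg (ContinuousOn.div (by fun_prop) (by fun_prop)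
      fun b hb => ?_)) (ContinuousOn.div (by fun_prop) (by fun_prop)
      fun b hb => mul_ne_zero (hne hb _ _) (hne hb _ _))
    have h {w : ℂ} (hw : ‖w‖ = 1) : 1 - w * b * q ≠ 0 :=
      one_sub_ne_zero_of_norm_lt_one (norm_mul_lt_one (by simpa [hw] using hb) hq)
    exact mul_ne_zero (h norm_omega) (h (by rw [norm_pow, norm_omega, one_pow]))

/-- Both sides are continuous in `b`, so the case `b = 0` follows from `b ≠ 0`. -/
theorem form_pLaurent {q b : ℂ} (hq0 : q ≠ 0) (hq : ‖q‖ < 1) (hb : ‖b‖ < 1) (m n : ℕ) :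
    form q b (pLaurent q b m) (pLaurent q b n) = if m = n then hNorm q b m else 0 := by
  by_cases hb0 : b ≠ 0
  · exact form_pLaurent_of_ne_zero hq0 hq hb0 hb m n
  rw [not_not] at hb0
  subst hb0
  have hR : ContinuousOn (fun b => if m = n then hNorm q b m else 0) (ball 0 1) := by
    split_ifs
    · exact continuousOn_hNorm hq m
    · exact continuousOn_const
  have hball : ball (0 : ℂ) 1 ∈ 𝓝 0 := ball_mem_nhds 0 one_pos
  have h1 := ((continuousOn_form_pLaurent hq0 hq m n).continuousAt hball).tendsto.mono_left
    (nhdsWithin_le_nhds (s := {0}ᶜ))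
  have h2 := (hR.continuousAt hball).tendsto.mono_left (nhdsWithin_le_nhds (s := {0}ᶜ))
  refine tendsto_nhds_unique (h1.congr' ?_) h2
  filter_upwards [self_mem_nhdsWithin, mem_nhdsWithin_of_mem_nhds hball] with b hb0 hb1
  exact form_pLaurent_of_ne_zero hq0 hq hb0 (by simpa using hb1) m n

end AskeyWilsonLaurent

theorem mainTheorem12 (q b : ℂ) (hq₀ : q ≠ 0) (hq : ‖q‖ < 1) (hb : ‖b‖ < 1) :
    (∀ f g : LaurentPolynomial ℂ,
      CircleIntegrable (AskeyWilsonLaurent.integrand q b f g) 0 1) ∧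
    ∀ m n : ℕ,
      AskeyWilsonLaurent.form q b
          (AskeyWilsonLaurent.pLaurent q b m) (AskeyWilsonLaurent.pLaurent q b n) =
        if m = n then AskeyWilsonLaurent.hNorm q b m else 0 :=
  ⟨AskeyWilsonLaurent.circleIntegrable_integrand hq hb,
    AskeyWilsonLaurent.form_pLaurent hq₀ hq hb⟩
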